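/- Let $m\le n$, let $\sigma_1(X)\ge\dots\ge\sigma_m(X)\ge 0$ be the singular values of $X\in\mathbb{R}^{m\times n}$, and let $$F(X)=\sum_{i=1}^m g(\sigma_i(X))+f(X),\qquad X\in\mathbb{R}^{m\times n},$$ where $g$ is nonnegative, continuous, concave and monotonically increasing (in the weak sense) on $[0,\infty)$ (possibly nonsmooth), and $f:\mathbb{R}^{m\times n}\to[0,\infty)$ is differentiable with $\|\nabla f(X)-\nabla f(Y)\|_F\le L\|X-Y\|_F$ for all $X,Y$, for some $L>0$ ($f$ is possibly nonconvex). For $\theta>0$ let $\partial g(\theta)=\{v\in\mathbb{R}: g(y)\le g(\theta)+v(y-\theta)\ \text{for all } y\ge 0\}$ be the superdifferential of $g$ at $\theta$, and let $\partial g(0)=\{g'(0+)\}$, where $g'(0+)\in[0,\infty]$ is the right derivative. Let $\mu>L$, and let $\{X^k\}_{k\ge0}$ be generated by the Iteratively Reweighted Nuclear Norm algorithm: $X^0\in\mathbb{R}^{m\times n}$ and $w^0\in[0,\infty]^m$ are arbitrary, and for every $k\ge 0$, $X^{k+1}$ is a global minimizer over $X\in\mathbb{R}^{m\times n}$ of $$\sum_{i=1}^m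 w_i^k\sigma_i(X)+\frac{\mu}{2}\Big\|X-\Big(X^k-\frac1\mu\nabla f(X^k)\Big)\Big\|_F^2$$ (with $\infty\cdot 0=0$), and $w_i^{k+1}\in\partial g(\sigma_i(X^{k+1}))$ for $i=1,\dots,m$. Then every accumulation point $X^*$ of $\{X^k\}$ is a stationary point of $F$, i.e. $0\in\partial F(X^*)$, where $\partial F$ is the Clarke subdifferential: $G\in\partial F(X)$ if and only if $(G,-1)$ belongs to the Clarke normal cone of the epigraph of $F$ at $(X,F(X))$ (for locally Lipschitz $F$ this is the usual generalized gradient). -/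

import Mathlib

open Filter Topology
open scoped ENNReal

/- Matrices carry the Frobenius norm; its topology is the usual entrywise one. -/
attribute [local instance] Matrix.frobeniusNormedAddCommGroup Matrix.frobeniusNormedSpace

namespace IRNN

noncomputable section

variable {m n : ℕ}

/-- The singular values `σ 0 ≥ σ 1 ≥ … ≥ σ (m-1) ≥ 0` of a real `m × n` matrix, `m ≤ n`
(counted with multiplicity, zero-indexed). -/
def sv (X : Matrix (Fin m) (Fin n) ℝ) (i : Fin m) : ℝ :=
  (Matrix.toEuclideanLin X).singularValues i

/-- The Frobenius inner product `⟨A, B⟩ = tr (Aᵀ B)`. -/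
def frobInner (A B : Matrix (Fin m) (Fin n) ℝ) : ℝ := (A.transpose * B).trace

/-- The gradient of `f` at `X` for the Frobenius inner product: the matrix of partial
derivatives (meaningful where `f` is differentiable). -/
def matGrad (f : Matrix (Fin m) (Fin n) ℝ → ℝ) (X : Matrix (Fin m) (Fin n) ℝ) :
    Matrix (Fin m) (Fin n) ℝ :=
  Matrix.of fun i j => fderiv ℝ f X (Matrix.single i j 1)

/-- The objective `F(X) = ∑ i, g (σ_i X) + f X`. -/
def objective (g : ℝ → ℝ) (f : Matrix (Fin m) (Fin n) ℝ → ℝ) (X : Matrix (Fin m) (Fin n) ℝ) : ℝ :=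
  ∑ i, g (sv X i) + f X

/-- The penalty is nonnegative, continuous, concave and (weakly) increasing on `[0, ∞)`;
its values on the negative axis play no role. -/
structure IsPenalty (g : ℝ → ℝ) : Prop where
  nonneg : ∀ x, 0 ≤ x → 0 ≤ g x
  continuousOn : ContinuousOn g (Set.Ici 0)
  concaveOn : ConcaveOn ℝ (Set.Ici 0) g
  monotoneOn : MonotoneOn g (Set.Ici 0)

/-- The loss is nonnegative and differentiable, and its gradient is Lipschitz with constant `L > 0`
in the Frobenius norm. -/
structure IsLoss (f : Matrix (Fin m) (Fin n) ℝ → ℝ) (L : ℝ) : Prop where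
  nonneg : ∀ X, 0 ≤ f X
  differentiable : Differentiable ℝ f
  pos : 0 < L
  lipschitz : ∀ X Y, ‖matGrad f X - matGrad f Y‖ ≤ L * ‖X - Y‖

/-- `v` is a supergradient at `θ` of the concave function `g` on `[0, ∞)`. -/
def IsSupergradient (g : ℝ → ℝ) (v θ : ℝ) : Prop :=
  ∀ y, 0 ≤ y → g y ≤ g θ + v * (y - θ)

/-- The superdifferential of a penalty `g` at `θ ≥ 0`, as a subset of `[0, ∞]`. For `θ > 0` it is
the set of all supergradients, which are finite, and nonnegative since `g` is increasing. At the
boundary point `θ = 0` it consists of the right derivative `g'(0+) ∈ [0, ∞]` alone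
(for instance `λ` for `g θ = λ θ`, and `∞` for `g θ = λ θ ^ p`, `0 < p < 1`). -/
def superdifferential (g : ℝ → ℝ) (θ : ℝ) : Set ℝ≥0∞ :=
  {v | (0 < θ ∧ v ≠ ∞ ∧ IsSupergradient g v.toReal θ) ∨
    (θ = 0 ∧ Tendsto (fun y : ℝ => ENNReal.ofReal ((g y - g 0) / y)) (𝓝[>] 0) (𝓝 v))}

/-- The objective `∑ i, w_i σ_i(X) + (μ / 2) ‖X - Z‖²` of the weighted nuclear norm subproblem,
with `∞ * 0 = 0`: an infinite weight `w_i` imposes the constraint `σ_i(X) = 0`. -/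
def subproblem (μ : ℝ) (w : Fin m → ℝ≥0∞) (Z X : Matrix (Fin m) (Fin n) ℝ) : ℝ≥0∞ :=
  ∑ i, w i * ENNReal.ofReal (sv X i) + ENNReal.ofReal (μ / 2 * ‖X - Z‖ ^ 2)

/-- `(X k)`, with weights `(w k)`, is a sequence generated by the iteratively reweighted nuclear
norm algorithm with parameter `μ`: the initial `X 0`, `w 0` are arbitrary, `X (k+1)` is any global
minimizer of the subproblem with weights `w k` and centre `X k - μ⁻¹ ∇f (X k)`, and then the
weights `w (k+1)` are any elements of the superdifferentials of `g` at the singular values of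
`X (k+1)`. -/
structure IsIRNNSequence (g : ℝ → ℝ) (f : Matrix (Fin m) (Fin n) ℝ → ℝ) (μ : ℝ)
    (X : ℕ → Matrix (Fin m) (Fin n) ℝ) (w : ℕ → Fin m → ℝ≥0∞) : Prop where
  update_X : ∀ k Y, subproblem μ (w k) (X k - μ⁻¹ • matGrad f (X k)) (X (k + 1)) ≤
    subproblem μ (w k) (X k - μ⁻¹ • matGrad f (X k)) Y
  update_w : ∀ k i, w (k + 1) i ∈ superdifferential g (sv (X (k + 1)) i)

/-- The Clarke tangent cone of `C` at `x ∈ C`. -/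
def clarkeTangentCone {E : Type*} [NormedAddCommGroup E] [NormedSpace ℝ E] (C : Set E) (x : E) :
    Set E :=
  {v | ∀ (y : ℕ → E) (t : ℕ → ℝ), (∀ k, y k ∈ C) → Tendsto y atTop (𝓝 x) →
    (∀ k, 0 < t k) → Tendsto t atTop (𝓝 0) →
    ∃ u : ℕ → E, Tendsto u atTop (𝓝 v) ∧ ∀ k, y k + t k • u k ∈ C}

/-- The Clarke subdifferential (generalized gradient) of `F` at `X`: the matrices `G` such that
`(G, -1)` lies in the Clarke normal cone, the polar of the Clarke tangent cone, of the epigraph of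
`F` at `(X, F X)`. This is Clarke's definition for functions that need not be locally Lipschitz;
for locally Lipschitz `F` it is the usual generalized gradient. -/
def clarkeSubdifferential (F : Matrix (Fin m) (Fin n) ℝ → ℝ) (X : Matrix (Fin m) (Fin n) ℝ) :
    Set (Matrix (Fin m) (Fin n) ℝ) :=
  {G | ∀ (V : Matrix (Fin m) (Fin n) ℝ) (r : ℝ),
    (V, r) ∈ clarkeTangentCone {p : Matrix (Fin m) (Fin n) ℝ × ℝ | F p.1 ≤ p.2} (X, F X) →
      frobInner G V ≤ r}

/-- `X` is a stationary point of the problem `min F`. -/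
def IsStationaryPoint (F : Matrix (Fin m) (Fin n) ℝ → ℝ) (X : Matrix (Fin m) (Fin n) ℝ) : Prop :=
  (0 : Matrix (Fin m) (Fin n) ℝ) ∈ clarkeSubdifferential F X

end

end IRNN

namespace IRNN

open Matrix

/-! ### Frobenius inner product. -/

section Frobenius

variable {m n : ℕ}

/-! Let A be a cluster point. Concavity of g and the descent lemma show that, once the weights are
supergradients, each step lowers F by at least (μ - L)/2 times its squared length
(`IsIRNNSequence.sufficient_decrease`), so the steps tend to 0. As [0,∞]^m is compact, the weights
have a limit v along an ultrafilter on which the iterates tend to A, and A minimizes the subproblem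
with weights v and centre A - μ⁻¹∇f(A) (`IsIRNNSequence.exists_limit_weights`). Von Neumann's trace
inequality then yields common frames A = U diag(σ) Vᵀ and -∇f(A) = U diag(γ) Vᵀ
(`exists_common_svd`). Varying single singular values shows that γ_i is a supergradient of g at σ_i
when σ_i > 0, and 0 ≤ γ_i ≤ g'(0+) when σ_i = 0 (`subproblem_optimality`).

It remains to prove r ≥ 0 for every Clarke tangent (D, r) of the epigraph at A; F need not be
locally Lipschitz, since g'(0+) may be infinite. At a concave kink a supergradient bounds g only
from above, so moving from A in direction D gives no useful lower bound. Clarke tangency, however,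
allows moving base points: take A - tS, where S is the symmetric part of D on the block of positive
singular values. There Peierls' inequality bounds the penalty from above
(`eventually_sum_penalty_sv_le`). The endpoint is A + tQ with Q → R = D - S, which is skew on that
block; the positive singular values are then unchanged to first order, and nuclear norm duality
bounds the zero block from below (`exists_penalty_lower_bound`). In the difference the terms in γ
cancel against ∇f(A), except for a factor η - 1 on the zero block (`tangent_lower_bound`), and η → 1
finishes. -/

theorem frobInner_eq_sum (A B : Matrix (Fin m) (Fin n) ℝ) :
    frobInner A B = ∑ i, ∑ j, A i j * B i j := by
  simp only [frobInner, Matrix.trace, Matrix.diag, Matrix.mul_apply, Matrix.transpose_apply]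
  exact Finset.sum_comm

theorem frobInner_comm (A B : Matrix (Fin m) (Fin n) ℝ) : frobInner A B = frobInner B A := by
  simp only [frobInner_eq_sum, mul_comm]

theorem frobInner_add_right (A B C : Matrix (Fin m) (Fin n) ℝ) :
    frobInner A (B + C) = frobInner A B + frobInner A C := by
  simp [frobInner, Matrix.mul_add]

theorem frobInner_sub_right (A B C : Matrix (Fin m) (Fin n) ℝ) :
    frobInner A (B - C) = frobInner A B - frobInner A C := by
  simp [frobInner, Matrix.mul_sub]

theorem frobInner_smul_right (c : ℝ) (A B : Matrix (Fin m) (Fin n) ℝ) :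
    frobInner A (c • B) = c * frobInner A B := by
  simp [frobInner]

theorem frobInner_add_left (A B C : Matrix (Fin m) (Fin n) ℝ) :
    frobInner (A + B) C = frobInner A C + frobInner B C := by
  simp [frobInner, Matrix.add_mul]

theorem frobInner_sub_left (A B C : Matrix (Fin m) (Fin n) ℝ) :
    frobInner (A - B) C = frobInner A C - frobInner B C := by
  simp [frobInner, Matrix.sub_mul]

theorem frobInner_smul_left (c : ℝ) (A B : Matrix (Fin m) (Fin n) ℝ) :
    frobInner (c • A) B = c * frobInner A B := by
  simp [frobInner]

theorem frobInner_self (A : Matrix (Fin m) (Fin n) ℝ) : frobInner A A = ‖A‖ ^ 2 := by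
  rw [Matrix.frobenius_norm_def, frobInner_eq_sum, ← Real.rpow_natCast, ← Real.rpow_mul]
  · norm_num [pow_two]
  · positivity

theorem norm_add_sq_frob (A B : Matrix (Fin m) (Fin n) ℝ) :
    ‖A + B‖ ^ 2 = ‖A‖ ^ 2 + 2 * frobInner A B + ‖B‖ ^ 2 := by
  rw [← frobInner_self, ← frobInner_self, ← frobInner_self, frobInner_add_left,
    frobInner_add_right, frobInner_add_right, frobInner_comm B A]
  ring

theorem norm_sub_sq_frob (A B : Matrix (Fin m) (Fin n) ℝ) :
    ‖A - B‖ ^ 2 = ‖A‖ ^ 2 - 2 * frobInner A B + ‖B‖ ^ 2 := by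
  rw [← frobInner_self, ← frobInner_self, ← frobInner_self, frobInner_sub_left,
    frobInner_sub_right, frobInner_sub_right, frobInner_comm B A]
  ring

theorem frobInner_le_norm_mul_norm (A B : Matrix (Fin m) (Fin n) ℝ) :
    frobInner A B ≤ ‖A‖ * ‖B‖ := by
  rw [← abs_of_nonneg (mul_nonneg (norm_nonneg A) (norm_nonneg B))]
  apply le_trans (le_abs_self _)
  apply sq_le_sq.mp
  rw [mul_pow, ← frobInner_self A, ← frobInner_self B]
  simp only [frobInner_eq_sum, ← Fintype.sum_prod_type', ← pow_two]
  exact Finset.sum_mul_sq_le_sq_mul_sq _ (fun p : Fin m × Fin n => A p.1 p.2) fun p => B p.1 p.2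

theorem tendsto_frobInner {ι : Type*} {l : Filter ι} {a b : ι → Matrix (Fin m) (Fin n) ℝ}
    {A B : Matrix (Fin m) (Fin n) ℝ} (ha : Tendsto a l (𝓝 A)) (hb : Tendsto b l (𝓝 B)) :
    Tendsto (fun k => frobInner (a k) (b k)) l (𝓝 (frobInner A B)) := by
  simp only [frobInner_eq_sum]
  exact tendsto_finsetSum _ fun i _ => tendsto_finsetSum _ fun j _ =>
    (((continuous_id.matrix_elem i j).tendsto A).comp ha).mul
      (((continuous_id.matrix_elem i j).tendsto B).comp hb)

theorem frobInner_mul_mul (U : Matrix (Fin m) (Fin m) ℝ) (K : Matrix (Fin m) (Fin m) ℝ)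
    (V : Matrix (Fin n) (Fin m) ℝ) (W : Matrix (Fin m) (Fin n) ℝ) :
    frobInner (U * K * Vᵀ) W = frobInner K (Uᵀ * W * V) := by
  simp only [frobInner, Matrix.transpose_mul, Matrix.transpose_transpose]
  rw [Matrix.mul_assoc, Matrix.trace_mul_comm]
  simp only [Matrix.mul_assoc]

theorem frobInner_diagonal (d : Fin m → ℝ) (B : Matrix (Fin m) (Fin m) ℝ) :
    frobInner (Matrix.diagonal d) B = ∑ i, d i * B i i := by
  rw [frobInner_eq_sum]
  refine Finset.sum_congr rfl fun i _ => ?_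
  rw [Finset.sum_eq_single i]
  · simp
  · intro j _ hj
    simp [Matrix.diagonal_apply_ne' _ hj]
  · simp

end Frobenius

/-! ### Existence of the singular value decomposition. -/

section SVD

variable {m n : ℕ}

/-- `X = U diag(s) Vᵀ` with orthonormal columns in `U`, `V` and nonnegative, not necessarily
ordered, `s`. -/
structure IsSVD (X : Matrix (Fin m) (Fin n) ℝ) (U : Matrix (Fin m) (Fin m) ℝ)
    (V : Matrix (Fin n) (Fin m) ℝ) (s : Fin m → ℝ) : Prop where
  left : Uᵀ * U = 1
  right : Vᵀ * V = 1
  eq : X = U * Matrix.diagonal s * Vᵀ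
  nonneg : ∀ i, 0 ≤ s i

theorem sv_nonneg (X : Matrix (Fin m) (Fin n) ℝ) (i : Fin m) : 0 ≤ sv X i :=
  LinearMap.singularValues_nonneg _ _

theorem sv_antitone (X : Matrix (Fin m) (Fin n) ℝ) : Antitone (sv X) := fun _ _ h =>
  LinearMap.singularValues_antitone _ h

/-- The right factor consists of eigenvectors of TᵀT; the left one of their normalized images,
completed to an orthonormal basis to cover vanishing singular values. -/
theorem exists_isSVD (hmn : m ≤ n) (X : Matrix (Fin m) (Fin n) ℝ) :
    ∃ U V, IsSVD X U V (sv X) := by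
  set T := Matrix.toEuclideanLin X with hT
  have hn : Module.finrank ℝ (EuclideanSpace ℝ (Fin n)) = n := finrank_euclideanSpace_fin
  set b := T.isSymmetric_adjoint_comp_self.eigenvectorBasis hn with hb
  have hinner : ∀ i j, inner ℝ (T (b i)) (T (b j)) =
      if i = j then T.singularValues i ^ 2 else 0 := by
    intro i j
    rw [T.sq_singularValues_fin hn, ← LinearMap.adjoint_inner_left, ← LinearMap.comp_apply,
      hb, T.isSymmetric_adjoint_comp_self.apply_eigenvectorBasis hn, ← hb, inner_smul_left,
      orthonormal_iff_ite.mp b.orthonormal]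
    split_ifs <;> simp
  have hzero : ∀ i : Fin n, T.singularValues i = 0 → T (b i) = 0 := by
    intro i hi
    have := hinner i i
    simpa [hi] using this
  -- The rank is at most m, so discarding the eigenvectors beyond the first m loses nothing.
  have hlarge : ∀ i : Fin n, m ≤ i → T.singularValues i = 0 := by
    intro i hi
    rw [T.singularValues_eq_zero_iff_le_finrank_range]
    have := Submodule.finrank_le (LinearMap.range T)
    rw [finrank_euclideanSpace_fin] at this
    omega
  set e : Fin m → Fin n := Fin.castLE hmn
  have he : Function.Injective e := Fin.castLE_injective hmn
  have hsv : ∀ i, sv X i = T.singularValues (e i) := fun i => rfl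
  let p : Fin m → EuclideanSpace ℝ (Fin m) := fun i => (sv X i)⁻¹ • T (b (e i))
  have hp : Orthonormal ℝ (Set.domRestrict {i | sv X i ≠ 0} p) := by
    rw [orthonormal_iff_ite]
    rintro ⟨i, hi⟩ ⟨j, hj⟩
    simp only [Set.domRestrict_apply, p, inner_smul_left, inner_smul_right, hinner,
      he.eq_iff, Subtype.mk.injEq]
    split_ifs with h
    · subst h
      have hi : sv X i ≠ 0 := hi
      simp only [hsv] at hi ⊢
      simp
      field_simp
    · simp
  obtain ⟨c, hc⟩ := hp.exists_orthonormalBasis_extension_of_card_eq (by simp)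
  have hTb : ∀ i, T (b (e i)) = sv X i • c i := by
    intro i
    by_cases hi : sv X i = 0
    · rw [hi, zero_smul]
      exact hzero _ (by rw [← hsv]; exact hi)
    · rw [hc i hi]
      simp [p, hi]
  have hT0 : ∀ j, j ∉ Set.range e → T (b j) = 0 := by
    intro j hj
    apply hzero _ (hlarge _ _)
    by_contra h
    exact hj ⟨⟨j, by omega⟩, rfl⟩
  refine ⟨Matrix.of fun a i => c i a, Matrix.of fun a i => b (e i) a, ?_, ?_, ?_, sv_nonneg X⟩
  · ext i j
    have := orthonormal_iff_ite.mp c.orthonormal j i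
    simp only [PiLp.inner_apply, RCLike.inner_apply, conj_trivial] at this
    simp [Matrix.mul_apply, Matrix.one_apply, this, eq_comm]
  · ext i j
    have := orthonormal_iff_ite.mp b.orthonormal (e j) (e i)
    simp only [PiLp.inner_apply, RCLike.inner_apply, conj_trivial] at this
    simp [Matrix.mul_apply, Matrix.one_apply, this, he.eq_iff, eq_comm]
  · ext a d
    have h1 : ∀ x, T x = ∑ j, inner ℝ (b j) x • T (b j) := by
      intro x
      conv_lhs => rw [← b.sum_repr' x]
      simp
    have h2 : X a d = T (EuclideanSpace.single d 1) a := by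
      simp [hT, Matrix.toLpLin_apply]
    rw [h2, h1, ← Finset.sum_subset (Finset.subset_univ (Finset.univ.map ⟨e, he⟩))]
    · rw [Matrix.mul_apply]
      simp only [Finset.sum_map, Function.Embedding.coeFn_mk, hTb,
        Matrix.mul_diagonal, Matrix.transpose_apply, Matrix.of_apply]
      simp [EuclideanSpace.inner_single_right]
      refine Finset.sum_congr rfl fun i _ => by ring
    · intro j _ hj
      rw [hT0 j (by simpa using hj), smul_zero]

end SVD

/-! ### Von Neumann's trace inequality. -/

section VonNeumann

/-- Abel summation, organized as an induction that splits off the constant `b (Fin.last m)`. -/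
theorem sum_mul_nonneg_of_partial_sums_nonneg {m : ℕ} (b d : Fin m → ℝ) (hb : Antitone b)
    (hb0 : ∀ i, 0 ≤ b i) (hd : ∀ l, 0 ≤ ∑ i, if i ≤ l then d i else 0) :
    0 ≤ ∑ i, b i * d i := by
  induction m with
  | zero => simp
  | succ m ih =>
    have h1 := ih (fun i => b i.castSucc - b (Fin.last m)) (fun i => d i.castSucc)
      (fun i j h => by simpa using hb (Fin.castSucc_le_castSucc_iff.mpr h))
      (fun i => sub_nonneg.mpr (hb (Fin.le_last _)))
      (fun l => by
        have := hd l.castSucc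
        rw [Fin.sum_univ_castSucc] at this
        have hl : ¬ Fin.last m ≤ l.castSucc := not_le.mpr (Fin.castSucc_lt_last l)
        simpa [hl] using this)
    have h2 := hd (Fin.last m)
    simp only [Fin.le_last, if_true] at h2
    have h3 := mul_nonneg (hb0 (Fin.last m)) h2
    rw [Fin.sum_univ_castSucc] at h3 ⊢
    simp only [sub_mul, Finset.sum_sub_distrib, ← Finset.mul_sum] at h1
    linarith

/-- Mass at most l + 1, with at most 1 at each place, is best spent on the l + 1 largest values:
compare every a_i with the threshold a_l. -/
theorem sum_mul_le_sum_initial {m : ℕ} (a q : Fin m → ℝ) (ha : Antitone a) (ha0 : ∀ i, 0 ≤ a i)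
    (hq0 : ∀ i, 0 ≤ q i) (hq1 : ∀ i, q i ≤ 1) (l : Fin m) (hq : ∑ i, q i ≤ (l : ℝ) + 1) :
    ∑ i, a i * q i ≤ ∑ i, if i ≤ l then a i else 0 := by
  have hcard : ∑ i : Fin m, (if i ≤ l then (1 : ℝ) else 0) = (l : ℝ) + 1 := by
    rw [Finset.sum_boole, Finset.filter_ge_eq_Iic, Fin.card_Iic]
    push_cast
    ring
  have h : ∑ i, a l * ((if i ≤ l then (1 : ℝ) else 0) - q i) ≤
      ∑ i, a i * ((if i ≤ l then (1 : ℝ) else 0) - q i) := by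
    refine Finset.sum_le_sum fun i _ => ?_
    split_ifs with hi
    · exact mul_le_mul_of_nonneg_right (ha hi) (by linarith [hq1 i])
    · have := ha (not_le.mp hi).le
      nlinarith [hq0 i]
  rw [← Finset.mul_sum, Finset.sum_sub_distrib, hcard] at h
  have h0 := mul_nonneg (ha0 l) (sub_nonneg.mpr hq)
  simp only [mul_sub, Finset.sum_sub_distrib, mul_ite, mul_one, mul_zero] at h
  rw [← mul_sub] at h
  linarith

/-- Replaces Birkhoff's theorem: the column sums of a_i p_ij have partial sums dominated by those of
a, and Abel summation against b concludes. -/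
theorem sum_mul_mul_le_of_substochastic {m : ℕ} (a b : Fin m → ℝ) (p : Fin m → Fin m → ℝ)
    (ha : Antitone a) (ha0 : ∀ i, 0 ≤ a i) (hb : Antitone b) (hb0 : ∀ i, 0 ≤ b i)
    (hp : ∀ i j, 0 ≤ p i j) (hrow : ∀ i, ∑ j, p i j ≤ 1) (hcol : ∀ j, ∑ i, p i j ≤ 1) :
    ∑ i, ∑ j, a i * p i j * b j ≤ ∑ i, a i * b i := by
  have h := sum_mul_nonneg_of_partial_sums_nonneg b (fun j => a j - ∑ i, a i * p i j) hb hb0 ?_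
  · simp only [mul_sub, Finset.sum_sub_distrib, Finset.mul_sum] at h
    rw [Finset.sum_comm]
    have e1 : ∑ j, ∑ i, a i * p i j * b j = ∑ j, ∑ i, b j * (a i * p i j) :=
      Finset.sum_congr rfl fun j _ => Finset.sum_congr rfl fun i _ => by ring
    have e2 : ∑ i, a i * b i = ∑ i, b i * a i := Finset.sum_congr rfl fun i _ => mul_comm _ _
    linarith
  · intro l
    have h1 := sum_mul_le_sum_initial a (fun i => ∑ j, if j ≤ l then p i j else 0) ha ha0
      (fun i => Finset.sum_nonneg fun j _ => by split_ifs <;> simp [hp])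
      (fun i => le_trans (Finset.sum_le_sum fun j _ => by split_ifs <;> simp [hp]) (hrow i)) l ?_
    · have e : ∑ j, (if j ≤ l then a j - ∑ i, a i * p i j else 0) =
          ∑ j, (if j ≤ l then a j else 0) - ∑ i, a i * ∑ j, if j ≤ l then p i j else 0 := by
        simp only [Finset.mul_sum]
        rw [Finset.sum_comm, ← Finset.sum_sub_distrib]
        refine Finset.sum_congr rfl fun j _ => ?_
        split_ifs <;> simp
      rw [e]
      linarith
    · rw [Finset.sum_comm]
      calc ∑ j, ∑ i, (if j ≤ l then p i j else 0)
          ≤ ∑ j : Fin m, (if j ≤ l then (1 : ℝ) else 0) := by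
            refine Finset.sum_le_sum fun j _ => ?_
            split_ifs
            · exact hcol j
            · simp
        _ = (l : ℝ) + 1 := by
            rw [Finset.sum_boole, Finset.filter_ge_eq_Iic, Fin.card_Iic]
            push_cast
            ring

/-- Bessel's inequality: the squared distance from x to the column span of W is nonnegative. -/
theorem dotProduct_self_transpose_mulVec_le {κ ι : Type*} [Fintype κ] [Fintype ι] [DecidableEq ι]
    (W : Matrix κ ι ℝ) (hW : Wᵀ * W = 1) (x : κ → ℝ) :
    (Wᵀ *ᵥ x) ⬝ᵥ (Wᵀ *ᵥ x) ≤ x ⬝ᵥ x := by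
  set y := Wᵀ *ᵥ x with hy
  have h0 : 0 ≤ (x - W *ᵥ y) ⬝ᵥ (x - W *ᵥ y) := by
    simp only [dotProduct, ← pow_two]
    exact Finset.sum_nonneg fun _ _ => sq_nonneg _
  have h1 : x ⬝ᵥ (W *ᵥ y) = y ⬝ᵥ y := by
    rw [Matrix.dotProduct_mulVec, ← Matrix.mulVec_transpose]
  have h2 : (W *ᵥ y) ⬝ᵥ (W *ᵥ y) = y ⬝ᵥ y := by
    rw [Matrix.dotProduct_mulVec, ← Matrix.mulVec_transpose, Matrix.mulVec_mulVec, hW,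
      Matrix.one_mulVec]
  rw [sub_dotProduct, dotProduct_sub, dotProduct_sub, h2, dotProduct_comm (W *ᵥ y) x, h1] at h0
  linarith

theorem sum_sq_transpose_mul_le_one {κ ι ι' : Type*} [Fintype κ] [Fintype ι] [DecidableEq ι]
    [Fintype ι'] [DecidableEq ι']
    (W : Matrix κ ι ℝ) (hW : Wᵀ * W = 1) (W' : Matrix κ ι' ℝ) (hW' : W'ᵀ * W' = 1) (i : ι') :
    ∑ j, (Wᵀ * W') j i ^ 2 ≤ 1 := by
  have h := dotProduct_self_transpose_mulVec_le W hW (fun a => W' a i)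
  have h1 : (fun a => W' a i) ⬝ᵥ (fun a => W' a i) = 1 := by
    have := congrFun (congrFun hW' i) i
    simpa [Matrix.mul_apply, dotProduct] using this
  rw [h1] at h
  refine le_trans (le_of_eq ?_) h
  simp only [dotProduct, Matrix.mulVec, Matrix.mul_apply, pow_two]

variable {m n : ℕ}

/-- Von Neumann's trace inequality. -/
theorem IsSVD.frobInner_le {X Y : Matrix (Fin m) (Fin n) ℝ} {U U' : Matrix (Fin m) (Fin m) ℝ}
    {V V' : Matrix (Fin n) (Fin m) ℝ} {s s' : Fin m → ℝ} (hX : IsSVD X U V s)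
    (hY : IsSVD Y U' V' s') (hs : Antitone s) (hs' : Antitone s') :
    frobInner X Y ≤ ∑ i, s i * s' i := by
  set P := Uᵀ * U' with hP
  set Q := V'ᵀ * V with hQ
  have hPt : ∀ i j, P i j = (U'ᵀ * U) j i := fun i j => by
    rw [← Matrix.transpose_apply (U'ᵀ * U), Matrix.transpose_mul, Matrix.transpose_transpose]
  have hQt : ∀ i j, Q i j = (Vᵀ * V') j i := fun i j => by
    rw [← Matrix.transpose_apply (Vᵀ * V'), Matrix.transpose_mul, Matrix.transpose_transpose]
  have h1 : frobInner X Y = ∑ i, ∑ j, s i * (P i j * Q j i) * s' j := by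
    rw [hX.eq, frobInner_mul_mul, frobInner_diagonal]
    refine Finset.sum_congr rfl fun i _ => ?_
    have : Uᵀ * Y * V = P * Matrix.diagonal s' * Q := by
      rw [hY.eq, hP, hQ]
      simp only [Matrix.mul_assoc]
    rw [this, Matrix.mul_apply, Finset.mul_sum]
    refine Finset.sum_congr rfl fun j _ => ?_
    rw [Matrix.mul_diagonal]
    ring
  -- The products P_ij Q_ji may be negative; their arithmetic-geometric bounds form a substochastic
  -- matrix because P and Q are contractions.
  have h2 : ∀ i j, P i j * Q j i ≤ (P i j ^ 2 + Q j i ^ 2) / 2 := fun i j => by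
    nlinarith [sq_nonneg (P i j - Q j i)]
  rw [h1]
  refine le_trans (Finset.sum_le_sum fun i _ => Finset.sum_le_sum fun j _ =>
    mul_le_mul_of_nonneg_right (mul_le_mul_of_nonneg_left (h2 i j) (hX.nonneg i)) (hY.nonneg j))
    (sum_mul_mul_le_of_substochastic s s' (fun i j => (P i j ^ 2 + Q j i ^ 2) / 2) hs hX.nonneg
      hs' hY.nonneg (fun i j => by positivity) (fun i => ?_) (fun j => ?_))
  · rw [← Finset.sum_div, Finset.sum_add_distrib]
    have a1 := sum_sq_transpose_mul_le_one U' hY.left U hX.left i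
    have a2 := sum_sq_transpose_mul_le_one V' hY.right V hX.right i
    simp only [hPt]
    linarith
  · rw [← Finset.sum_div, Finset.sum_add_distrib]
    have a1 := sum_sq_transpose_mul_le_one U hX.left U' hY.left j
    have a2 := sum_sq_transpose_mul_le_one V hX.right V' hY.right j
    simp only [hQt]
    linarith

end VonNeumann

/-! ### Uniqueness, continuity and bounds for singular values. -/

section SingularValues

variable {m n : ℕ}

theorem IsSVD.transpose_mul_mul {X : Matrix (Fin m) (Fin n) ℝ} {U : Matrix (Fin m) (Fin m) ℝ}
    {V : Matrix (Fin n) (Fin m) ℝ} {s : Fin m → ℝ} (h : IsSVD X U V s) :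
    Uᵀ * X * V = Matrix.diagonal s := by
  rw [h.eq, ← Matrix.mul_assoc, ← Matrix.mul_assoc, h.left, Matrix.one_mul, Matrix.mul_assoc,
    h.right, Matrix.mul_one]

theorem norm_mul_diagonal_mul_sq {U : Matrix (Fin m) (Fin m) ℝ} {V : Matrix (Fin n) (Fin m) ℝ}
    (hU : Uᵀ * U = 1) (hV : Vᵀ * V = 1) (d : Fin m → ℝ) :
    ‖U * Matrix.diagonal d * Vᵀ‖ ^ 2 = ∑ i, d i ^ 2 := by
  have h : Uᵀ * (U * Matrix.diagonal d * Vᵀ) * V = Matrix.diagonal d := by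
    rw [← Matrix.mul_assoc, ← Matrix.mul_assoc, hU, Matrix.one_mul, Matrix.mul_assoc, hV,
      Matrix.mul_one]
  rw [← frobInner_self, frobInner_mul_mul, h, frobInner_diagonal]
  simp [pow_two]

theorem IsSVD.norm_sq {X : Matrix (Fin m) (Fin n) ℝ} {U : Matrix (Fin m) (Fin m) ℝ}
    {V : Matrix (Fin n) (Fin m) ℝ} {s : Fin m → ℝ} (h : IsSVD X U V s) :
    ‖X‖ ^ 2 = ∑ i, s i ^ 2 := by
  rw [h.eq, norm_mul_diagonal_mul_sq h.left h.right]

theorem IsSVD.reindex {X : Matrix (Fin m) (Fin n) ℝ} {U : Matrix (Fin m) (Fin m) ℝ}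
    {V : Matrix (Fin n) (Fin m) ℝ} {s : Fin m → ℝ} (h : IsSVD X U V s)
    (π : Equiv.Perm (Fin m)) :
    IsSVD X (U.submatrix id π) (V.submatrix id π) (s ∘ π) where
  left := by
    rw [Matrix.transpose_submatrix, ← Matrix.submatrix_mul _ _ π id π Function.bijective_id,
      h.left, Matrix.submatrix_one_equiv]
  right := by
    rw [Matrix.transpose_submatrix, ← Matrix.submatrix_mul _ _ π id π Function.bijective_id,
      h.right, Matrix.submatrix_one_equiv]
  eq := by
    rw [← Matrix.submatrix_diagonal_equiv, ← Matrix.submatrix_mul _ _ id π π π.bijective,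
      Matrix.transpose_submatrix, ← Matrix.submatrix_mul _ _ id π id π.bijective, ← h.eq,
      Matrix.submatrix_id_id]
  nonneg i := h.nonneg _

/-- The trace inequality for X against itself gives Σ s_i² ≤ Σ s_i s'_i, while both squared norms
equal ‖X‖². -/
theorem IsSVD.eq_of_antitone {X : Matrix (Fin m) (Fin n) ℝ} {U U' : Matrix (Fin m) (Fin m) ℝ}
    {V V' : Matrix (Fin n) (Fin m) ℝ} {s s' : Fin m → ℝ} (h : IsSVD X U V s)
    (h' : IsSVD X U' V' s') (hs : Antitone s) (hs' : Antitone s') : s = s' := by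
  have h1 := h.frobInner_le h' hs hs'
  rw [frobInner_self] at h1
  have h2 : ∑ i, (s i - s' i) ^ 2 ≤ 0 := by
    have : ∑ i, (s i - s' i) ^ 2 = ∑ i, s i ^ 2 - 2 * ∑ i, s i * s' i + ∑ i, s' i ^ 2 := by
      rw [Finset.mul_sum, ← Finset.sum_sub_distrib, ← Finset.sum_add_distrib]
      exact Finset.sum_congr rfl fun i _ => by ring
    rw [this, ← h.norm_sq, ← h'.norm_sq]
    linarith
  have h3 := (Finset.sum_eq_zero_iff_of_nonneg fun i _ => sq_nonneg (s i - s' i)).mp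
    (le_antisymm h2 (Finset.sum_nonneg fun i _ => sq_nonneg _))
  funext i
  have := h3 i (Finset.mem_univ i)
  exact sub_eq_zero.mp (pow_eq_zero_iff two_ne_zero |>.mp this)

theorem IsSVD.sv_eq (hmn : m ≤ n) {X : Matrix (Fin m) (Fin n) ℝ} {U : Matrix (Fin m) (Fin m) ℝ}
    {V : Matrix (Fin n) (Fin m) ℝ} {s : Fin m → ℝ} (h : IsSVD X U V s) (hs : Antitone s) :
    sv X = s := by
  obtain ⟨U', V', h'⟩ := exists_isSVD hmn X
  exact h'.eq_of_antitone h (sv_antitone X) hs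

theorem IsSVD.exists_perm (hmn : m ≤ n) {X : Matrix (Fin m) (Fin n) ℝ}
    {U : Matrix (Fin m) (Fin m) ℝ} {V : Matrix (Fin n) (Fin m) ℝ} {s : Fin m → ℝ}
    (h : IsSVD X U V s) : ∃ π : Equiv.Perm (Fin m), sv X = s ∘ π := by
  -- `Tuple.sort` sorts increasingly, hence the reversal.
  refine ⟨Fin.revPerm.trans (Tuple.sort s), (h.reindex _).sv_eq hmn ?_⟩
  intro i j hij
  exact Tuple.monotone_sort s (Fin.rev_le_rev.mpr hij)

/-- Expand both squares: the norms agree, and the trace inequality compares the cross terms.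
Continuity of the singular values follows. -/
theorem sum_sv_sub_sq_le (hmn : m ≤ n) (X Y : Matrix (Fin m) (Fin n) ℝ) :
    ∑ i, (sv X i - sv Y i) ^ 2 ≤ ‖X - Y‖ ^ 2 := by
  obtain ⟨U, V, h⟩ := exists_isSVD hmn X
  obtain ⟨U', V', h'⟩ := exists_isSVD hmn Y
  have h1 := h.frobInner_le h' (sv_antitone X) (sv_antitone Y)
  rw [norm_sub_sq_frob, h.norm_sq, h'.norm_sq]
  have : ∑ i, (sv X i - sv Y i) ^ 2 =
      ∑ i, sv X i ^ 2 - 2 * ∑ i, sv X i * sv Y i + ∑ i, sv Y i ^ 2 := by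
    rw [Finset.mul_sum, ← Finset.sum_sub_distrib, ← Finset.sum_add_distrib]
    exact Finset.sum_congr rfl fun i _ => by ring
  linarith

theorem abs_sv_sub_le (hmn : m ≤ n) (X Y : Matrix (Fin m) (Fin n) ℝ) (i : Fin m) :
    |sv X i - sv Y i| ≤ ‖X - Y‖ := by
  apply abs_le_of_sq_le_sq _ (norm_nonneg _)
  exact le_trans (Finset.single_le_sum (f := fun i => (sv X i - sv Y i) ^ 2)
    (fun i _ => sq_nonneg _) (Finset.mem_univ i)) (sum_sv_sub_sq_le hmn X Y)

theorem continuous_sv (hmn : m ≤ n) (i : Fin m) :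
    Continuous fun X : Matrix (Fin m) (Fin n) ℝ => sv X i := by
  refine LipschitzWith.continuous (K := 1) (LipschitzWith.of_dist_le_mul fun X Y => ?_)
  rw [Real.dist_eq, dist_eq_norm]
  simpa using abs_sv_sub_le hmn X Y i

/-- Duality of the nuclear and the operator norm, for `K = U diag(c) Vᵀ` with `0 ≤ c ≤ 1`. -/
theorem sum_mul_diag_le_sum_sv (hmn : m ≤ n) (M : Matrix (Fin m) (Fin n) ℝ)
    {U : Matrix (Fin m) (Fin m) ℝ} {V : Matrix (Fin n) (Fin m) ℝ} (hU : Uᵀ * U = 1)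
    (hV : Vᵀ * V = 1) (c : Fin m → ℝ) (hc0 : ∀ i, 0 ≤ c i) (hc1 : ∀ i, c i ≤ 1) :
    ∑ i, c i * (Uᵀ * M * V) i i ≤ ∑ i, sv M i := by
  have hK : IsSVD (U * Matrix.diagonal c * Vᵀ) U V c := ⟨hU, hV, rfl, hc0⟩
  obtain ⟨π, hπ⟩ := hK.exists_perm hmn
  obtain ⟨U1, V1, h1⟩ := exists_isSVD hmn (U * Matrix.diagonal c * Vᵀ)
  obtain ⟨U2, V2, h2⟩ := exists_isSVD hmn M
  have h := h1.frobInner_le h2 (sv_antitone _) (sv_antitone _)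
  rw [frobInner_mul_mul, frobInner_diagonal] at h
  refine h.trans (Finset.sum_le_sum fun i _ => ?_)
  rw [hπ]
  exact mul_le_of_le_one_left (sv_nonneg M i) (hc1 _)

/-- A lower bound for a singular value by compression to a subspace. -/
theorem le_sv_of_compression (hmn : m ≤ n) (M : Matrix (Fin m) (Fin n) ℝ)
    {U : Matrix (Fin m) (Fin m) ℝ} {V : Matrix (Fin n) (Fin m) ℝ} (hU : Uᵀ * U = 1)
    (hV : Vᵀ * V = 1) (i : Fin m) (c : ℝ)
    (hc : ∀ x : Fin m → ℝ, (∀ j, i < j → x j = 0) →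
      c * (x ⬝ᵥ x) ≤ x ⬝ᵥ ((Uᵀ * M * V) *ᵥ x)) :
    c ≤ sv M i := by
  obtain ⟨U', V', h⟩ := exists_isSVD hmn M
  -- Dimension count: one linear condition for each index other than i, thus m - 1 conditions on m
  -- coordinates.
  obtain ⟨x, hx0, hxi, hxl⟩ : ∃ x : Fin m → ℝ, x ≠ 0 ∧ (∀ j, i < j → x j = 0) ∧
      ∀ l, l < i → ((V'ᵀ * V) *ᵥ x) l = 0 := by
    let φ : (Fin m → ℝ) →ₗ[ℝ] ({j : Fin m // j ≠ i} → ℝ) := LinearMap.pi fun j =>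
      if j.1 < i then (LinearMap.proj j.1).comp (Matrix.mulVecLin (V'ᵀ * V))
      else LinearMap.proj j.1
    have hker : LinearMap.ker φ ≠ ⊥ := by
      apply LinearMap.ker_ne_bot_of_finrank_lt
      simp only [Module.finrank_fintype_fun_eq_card, Fintype.card_subtype_compl,
        Fintype.card_fin, Fintype.card_unique]
      have := i.pos
      omega
    obtain ⟨x, hx, hx0⟩ := Submodule.exists_mem_ne_zero_of_ne_bot hker
    have hφ : ∀ j : {j : Fin m // j ≠ i}, φ x j = 0 := fun j => by
      rw [LinearMap.mem_ker.mp hx]; rfl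
    refine ⟨x, hx0, fun j hj => ?_, fun l hl => ?_⟩
    · simpa [φ, not_lt.mpr hj.le] using hφ ⟨j, hj.ne'⟩
    · have := hφ ⟨l, hl.ne⟩
      simpa only [φ, LinearMap.pi_apply, if_pos hl, LinearMap.comp_apply, LinearMap.proj_apply,
        Matrix.mulVecLin_apply] using this
  set p := (U'ᵀ * U) *ᵥ x with hp
  set q := (V'ᵀ * V) *ᵥ x with hq
  have hxx : 0 < x ⬝ᵥ x := by
    refine lt_of_le_of_ne (Finset.sum_nonneg fun j _ => mul_self_nonneg (x j)) fun h0 => hx0 ?_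
    exact dotProduct_self_eq_zero.mp h0.symm
  have hpp : p ⬝ᵥ p ≤ x ⬝ᵥ x := by
    rw [hp, ← Matrix.mulVec_mulVec]
    refine (dotProduct_self_transpose_mulVec_le U' h.left _).trans (le_of_eq ?_)
    rw [Matrix.dotProduct_mulVec, ← Matrix.mulVec_transpose, Matrix.mulVec_mulVec, hU,
      Matrix.one_mulVec]
  have hqq : q ⬝ᵥ q ≤ x ⬝ᵥ x := by
    rw [hq, ← Matrix.mulVec_mulVec]
    refine (dotProduct_self_transpose_mulVec_le V' h.right _).trans (le_of_eq ?_)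
    rw [Matrix.dotProduct_mulVec, ← Matrix.mulVec_transpose, Matrix.mulVec_mulVec, hV,
      Matrix.one_mulVec]
  have hform : x ⬝ᵥ ((Uᵀ * M * V) *ᵥ x) = ∑ l, p l * (sv M l * q l) := by
    have e : Uᵀ * M * V = (U'ᵀ * U)ᵀ * (Matrix.diagonal (sv M) * (V'ᵀ * V)) := by
      conv_lhs => rw [h.eq]
      simp only [Matrix.transpose_mul, Matrix.transpose_transpose, Matrix.mul_assoc]
    rw [e, ← Matrix.mulVec_mulVec, Matrix.dotProduct_mulVec, Matrix.vecMul_transpose, ← hp,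
      ← Matrix.mulVec_mulVec, ← hq]
    simp [dotProduct, Matrix.mulVec_diagonal]
  have hle : ∑ l, p l * (sv M l * q l) ≤ ∑ l, sv M i * ((p l * p l + q l * q l) / 2) := by
    refine Finset.sum_le_sum fun l _ => ?_
    rcases lt_or_ge l i with hl | hl
    · rw [hxl l hl]
      have := mul_nonneg (sv_nonneg M i) (mul_self_nonneg (p l))
      simp
      linarith
    · have h1 := sv_antitone M hl
      have h2 : p l * q l ≤ (p l * p l + q l * q l) / 2 := by nlinarith [sq_nonneg (p l - q l)]
      have h3 : 0 ≤ (p l * p l + q l * q l) / 2 := by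
        nlinarith [mul_self_nonneg (p l), mul_self_nonneg (q l)]
      nlinarith [sv_nonneg M l]
  rw [← Finset.mul_sum, ← Finset.sum_div, Finset.sum_add_distrib] at hle
  change _ ≤ sv M i * ((p ⬝ᵥ p + q ⬝ᵥ q) / 2) at hle
  have h4 := hc x hxi
  rw [hform] at h4
  have h5 : sv M i * ((p ⬝ᵥ p + q ⬝ᵥ q) / 2) ≤ sv M i * (x ⬝ᵥ x) :=
    mul_le_mul_of_nonneg_left (by linarith) (sv_nonneg M i)
  exact le_of_mul_le_mul_right (h4.trans (hle.trans h5)) hxx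

end SingularValues

/-! ### First-order optimality for the weighted nuclear norm subproblem. -/

section Subproblem

variable {m n : ℕ}

theorem mul_diagonal_mul_sub (U : Matrix (Fin m) (Fin m) ℝ) (V : Matrix (Fin n) (Fin m) ℝ)
    (a b : Fin m → ℝ) :
    U * Matrix.diagonal a * Vᵀ - U * Matrix.diagonal b * Vᵀ =
      U * Matrix.diagonal (fun i => a i - b i) * Vᵀ := by
  rw [← Matrix.sub_mul, ← Matrix.mul_sub, Matrix.diagonal_sub]

theorem mul_diagonal_mul_smul (U : Matrix (Fin m) (Fin m) ℝ) (V : Matrix (Fin n) (Fin m) ℝ)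
    (c : ℝ) (a : Fin m → ℝ) :
    c • (U * Matrix.diagonal a * Vᵀ) = U * Matrix.diagonal (fun i => c * a i) * Vᵀ := by
  have : Matrix.diagonal (fun i => c * a i) = c • Matrix.diagonal a := by
    rw [← Matrix.diagonal_smul]; rfl
  rw [this, Matrix.mul_smul, Matrix.smul_mul]

/-- A minimizer `X` of the subproblem with centre `Z = X + μ⁻¹ G` has a singular value
decomposition in common with `Z`. -/
theorem exists_common_svd (hmn : m ≤ n) {μ : ℝ} (hμ : 0 < μ) {w : Fin m → ℝ≥0∞}
    {X G : Matrix (Fin m) (Fin n) ℝ} (hfin : ∀ i, w i * ENNReal.ofReal (sv X i) ≠ ∞)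
    (hmin : ∀ Y, subproblem μ w (X + μ⁻¹ • G) X ≤ subproblem μ w (X + μ⁻¹ • G) Y) :
    ∃ U V s, IsSVD X U V (sv X) ∧ Antitone s ∧ (∀ i, 0 ≤ s i) ∧
      G = U * Matrix.diagonal (fun i => μ * (s i - 2 * sv X i)) * Vᵀ := by
  set Z := X + μ⁻¹ • G with hZ
  -- Decomposing X + Z instead of Z makes the argument rigid. The competitor Y has the singular
  -- values of X in the frames of X + Z; minimality gives ⟨Y, Z⟩ ≤ ⟨X, Z⟩ and the trace inequality
  -- ⟨X, X + Z⟩ ≤ ⟨Y, X + Z⟩, so ‖X‖² ≤ ⟨X, Y⟩ and X = Y.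
  obtain ⟨U, V, hN⟩ := exists_isSVD hmn (X + Z)
  obtain ⟨U', V', hX⟩ := exists_isSVD hmn X
  set Y := U * Matrix.diagonal (sv X) * Vᵀ with hYdef
  have hY : IsSVD Y U V (sv X) := ⟨hN.left, hN.right, rfl, sv_nonneg X⟩
  have hsvY : sv Y = sv X := hY.sv_eq hmn (sv_antitone X)
  have hsum : ∑ i, w i * ENNReal.ofReal (sv X i) ≠ ∞ := by
    rw [ENNReal.sum_ne_top]
    exact fun i _ => hfin i
  have h1 := hmin Y
  simp only [subproblem, hsvY] at h1
  rw [ENNReal.add_le_add_iff_left hsum, ENNReal.ofReal_le_ofReal_iff (by positivity)] at h1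
  have h2 : ‖X - Z‖ ^ 2 ≤ ‖Y - Z‖ ^ 2 := le_of_mul_le_mul_left h1 (by positivity)
  have h3 := hX.frobInner_le hN (sv_antitone _) (sv_antitone _)
  have h4 : frobInner Y (X + Z) = ∑ i, sv X i * sv (X + Z) i := by
    rw [hYdef, frobInner_mul_mul, hN.transpose_mul_mul, frobInner_diagonal]
    simp
  have h5 : ‖X‖ ^ 2 = ‖Y‖ ^ 2 := by rw [hX.norm_sq, hY.norm_sq]
  have hXY : X = Y := by
    rw [← sub_eq_zero, ← norm_eq_zero, ← pow_eq_zero_iff two_ne_zero]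
    apply le_antisymm _ (sq_nonneg _)
    have h6 := frobInner_self X
    rw [norm_sub_sq_frob] at h2 ⊢
    rw [norm_sub_sq_frob] at h2
    rw [← h4, frobInner_add_right X X Z, frobInner_add_right Y X Z,
      frobInner_comm Y X] at h3
    linarith
  refine ⟨U, V, sv (X + Z), hXY ▸ hY, sv_antitone _, sv_nonneg _, ?_⟩
  have e : G = μ • ((X + Z) - (2 : ℝ) • X) := by
    rw [hZ, two_smul, ← add_assoc, add_sub_cancel_left, smul_smul, mul_inv_cancel₀ hμ.ne',
      one_smul]
  rw [e, ← mul_diagonal_mul_smul, ← mul_diagonal_mul_sub, ← mul_diagonal_mul_smul, ← hN.eq,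
    ← hYdef, ← hXY]

/-- In the common frames the objective separates over the coordinates. The competitor must stay
ordered, because w_i multiplies the i-th largest singular value and the weights need not be
monotone. -/
theorem diagonal_variation (hmn : m ≤ n) {μ : ℝ} (hμ : 0 < μ) {w : Fin m → ℝ≥0∞}
    {X G : Matrix (Fin m) (Fin n) ℝ} (hfin : ∀ i, w i * ENNReal.ofReal (sv X i) ≠ ∞)
    (hmin : ∀ Y, subproblem μ w (X + μ⁻¹ • G) X ≤ subproblem μ w (X + μ⁻¹ • G) Y)
    {U : Matrix (Fin m) (Fin m) ℝ} {V : Matrix (Fin n) (Fin m) ℝ} {γ : Fin m → ℝ}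
    (hX : IsSVD X U V (sv X)) (hG : G = U * Matrix.diagonal γ * Vᵀ)
    (y : Fin m → ℝ) (hy : Antitone y) (hy0 : ∀ i, 0 ≤ y i)
    (hyfin : ∀ i, w i * ENNReal.ofReal (y i) ≠ ∞) :
    0 ≤ ∑ i, ((w i).toReal - γ i) * (y i - sv X i) + μ / 2 * ∑ i, (y i - sv X i) ^ 2 := by
  set Z := X + μ⁻¹ • G with hZ
  set Y := U * Matrix.diagonal y * Vᵀ with hYdef
  have hY : IsSVD Y U V y := ⟨hX.left, hX.right, rfl, hy0⟩
  have hsvY : sv Y = y := hY.sv_eq hmn hy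
  have hXZ : X - Z = U * Matrix.diagonal (fun i => -μ⁻¹ * γ i) * Vᵀ := by
    rw [← mul_diagonal_mul_smul, ← hG, hZ, neg_smul]
    abel
  have hYZ : Y - Z = U * Matrix.diagonal (fun i => y i - sv X i - μ⁻¹ * γ i) * Vᵀ := by
    rw [← mul_diagonal_mul_sub, ← mul_diagonal_mul_sub, ← hX.eq, ← mul_diagonal_mul_smul, ← hG,
      hZ, hYdef]
    abel
  have hsum : ∀ z : Fin m → ℝ, (∀ i, w i * ENNReal.ofReal (z i) ≠ ∞) → (∀ i, 0 ≤ z i) →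
      ∑ i, w i * ENNReal.ofReal (z i) = ENNReal.ofReal (∑ i, (w i).toReal * z i) := by
    intro z hz hz0
    rw [ENNReal.ofReal_sum_of_nonneg fun i _ => mul_nonneg ENNReal.toReal_nonneg (hz0 i)]
    refine Finset.sum_congr rfl fun i _ => ?_
    rw [← ENNReal.ofReal_toReal (hz i), ENNReal.toReal_mul, ENNReal.toReal_ofReal (hz0 i)]
  have h1 := hmin Y
  simp only [subproblem, hsvY] at h1
  have hn1 : 0 ≤ ∑ i, (w i).toReal * sv X i :=
    Finset.sum_nonneg fun i _ => mul_nonneg ENNReal.toReal_nonneg (sv_nonneg X i)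
  have hn2 : 0 ≤ ∑ i, (w i).toReal * y i :=
    Finset.sum_nonneg fun i _ => mul_nonneg ENNReal.toReal_nonneg (hy0 i)
  rw [hsum _ hfin (sv_nonneg X), hsum _ hyfin hy0, ← ENNReal.ofReal_add hn1 (by positivity),
    ← ENNReal.ofReal_add hn2 (by positivity), ENNReal.ofReal_le_ofReal_iff (by positivity),
    hXZ, hYZ, norm_mul_diagonal_mul_sq hX.left hX.right, norm_mul_diagonal_mul_sq hX.left hX.right,
    Finset.mul_sum, Finset.mul_sum, ← Finset.sum_add_distrib, ← Finset.sum_add_distrib,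
    ← sub_nonneg, ← Finset.sum_sub_distrib] at h1
  rw [Finset.mul_sum, ← Finset.sum_add_distrib]
  refine h1.trans (le_of_eq (Finset.sum_congr rfl fun i _ => ?_))
  field_simp
  ring

theorem nonneg_of_eventually_variation {a μ : ℝ}
    (h : ∀ᶠ ε in 𝓝[>] (0 : ℝ), 0 ≤ a * ε + μ / 2 * ε ^ 2) : 0 ≤ a := by
  have ht : Tendsto (fun ε : ℝ => a + μ / 2 * ε) (𝓝[>] 0) (𝓝 a) := by
    have : Tendsto (fun ε : ℝ => a + μ / 2 * ε) (𝓝 0) (𝓝 (a + μ / 2 * 0)) :=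
      Continuous.tendsto (by fun_prop) 0
    rw [mul_zero, add_zero] at this
    exact this.mono_left nhdsWithin_le_nhds
  refine ge_of_tendsto ht ?_
  filter_upwards [h, self_mem_nhdsWithin] with ε hε hpos
  have hpos : 0 < ε := hpos
  have : 0 ≤ ε * (a + μ / 2 * ε) := by linarith
  exact nonneg_of_mul_nonneg_right this hpos

theorem antitone_update {σ : Fin m → ℝ} (hσ : Antitone σ) {j : Fin m} {y : ℝ}
    (h1 : ∀ i, i < j → y ≤ σ i) (h2 : ∀ i, j < i → σ i ≤ y) :
    Antitone (Function.update σ j y) := by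
  intro a b hab
  rcases hab.eq_or_lt with rfl | hab'
  · rfl
  · by_cases ha : a = j
    · subst ha
      rw [Function.update_self, Function.update_of_ne hab'.ne']
      exact h2 b hab'
    · by_cases hb : b = j
      · subst hb
        rw [Function.update_self, Function.update_of_ne ha]
        exact h1 a hab'
      · rw [Function.update_of_ne ha, Function.update_of_ne hb]
        exact hσ hab

theorem single_variation (hmn : m ≤ n) {μ : ℝ} (hμ : 0 < μ) {w : Fin m → ℝ≥0∞}
    {X G : Matrix (Fin m) (Fin n) ℝ} (hfin : ∀ i, w i * ENNReal.ofReal (sv X i) ≠ ∞)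
    (hmin : ∀ Y, subproblem μ w (X + μ⁻¹ • G) X ≤ subproblem μ w (X + μ⁻¹ • G) Y)
    {U : Matrix (Fin m) (Fin m) ℝ} {V : Matrix (Fin n) (Fin m) ℝ} {γ : Fin m → ℝ}
    (hX : IsSVD X U V (sv X)) (hG : G = U * Matrix.diagonal γ * Vᵀ) {j : Fin m} (hw : w j ≠ ∞)
    {τ : ℝ} (hτ : τ ^ 2 = 1)
    (h : ∀ᶠ ε in 𝓝[>] (0 : ℝ), (∀ i, i < j → sv X j + τ * ε ≤ sv X i) ∧
      (∀ i, j < i → sv X i ≤ sv X j + τ * ε) ∧ 0 ≤ sv X j + τ * ε) :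
    0 ≤ ((w j).toReal - γ j) * τ := by
  refine nonneg_of_eventually_variation (μ := μ) ?_
  filter_upwards [h] with ε ⟨h1, h2, h3⟩
  have := diagonal_variation hmn hμ hfin hmin hX hG (Function.update (sv X) j (sv X j + τ * ε))
    (antitone_update (sv_antitone X) h1 h2) ?_ ?_
  · have e : ∀ i, Function.update (sv X) j (sv X j + τ * ε) i - sv X i =
        if i = j then τ * ε else 0 := by
      intro i
      by_cases hi : i = j
      · subst hi; simp
      · simp [hi]
    simp only [e] at this
    simp at this
    have e2 : (τ * ε) ^ 2 = ε ^ 2 := by rw [mul_pow, hτ, one_mul]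
    rw [e2] at this
    linarith
  · intro i
    by_cases hi : i = j
    · subst hi; simpa using h3
    · simpa [hi] using sv_nonneg X i
  · intro i
    by_cases hi : i = j
    · subst hi
      exact ENNReal.mul_ne_top hw ENNReal.ofReal_ne_top
    · simpa [hi] using hfin i

theorem eventually_add_mul_le {a b τ : ℝ} (h : a < b) :
    ∀ᶠ ε in 𝓝[>] (0 : ℝ), a + τ * ε ≤ b := by
  have ht : Tendsto (fun ε : ℝ => a + τ * ε) (𝓝[>] 0) (𝓝 a) := by
    have : Tendsto (fun ε : ℝ => a + τ * ε) (𝓝 0) (𝓝 (a + τ * 0)) :=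
      Continuous.tendsto (by fun_prop) 0
    rw [mul_zero, add_zero] at this
    exact this.mono_left nhdsWithin_le_nhds
  exact (ht.eventually_lt_const h).mono fun _ h => h.le

theorem eventually_le_add_mul {a b τ : ℝ} (h : b < a) :
    ∀ᶠ ε in 𝓝[>] (0 : ℝ), b ≤ a + τ * ε := by
  filter_upwards [eventually_add_mul_le (τ := -τ) (neg_lt_neg h)] with ε hε
  linarith

/-- First-order optimality for the subproblem: `G` and `X` have a common singular value
decomposition, and on every block of equal singular values of `X` the diagonal entries of `G` lie
between two weights of this block (only the upper bound holds on the zero block). -/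
theorem subproblem_optimality (hmn : m ≤ n) {μ : ℝ} (hμ : 0 < μ) {w : Fin m → ℝ≥0∞}
    {X G : Matrix (Fin m) (Fin n) ℝ} (hfin : ∀ i, w i * ENNReal.ofReal (sv X i) ≠ ∞)
    (hmin : ∀ Y, subproblem μ w (X + μ⁻¹ • G) X ≤ subproblem μ w (X + μ⁻¹ • G) Y) :
    ∃ U V γ, IsSVD X U V (sv X) ∧ G = U * Matrix.diagonal γ * Vᵀ ∧
      (∀ i, sv X i = 0 → 0 ≤ γ i) ∧
      (∀ i, ∃ j, sv X j = sv X i ∧ (w j ≠ ∞ → γ i ≤ (w j).toReal)) ∧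
      (∀ i, 0 < sv X i → ∃ j, sv X j = sv X i ∧ (w j).toReal ≤ γ i) := by
  obtain ⟨U, V, s, hX, hs, hs0, hG⟩ := exists_common_svd hmn hμ hfin hmin
  refine ⟨U, V, _, hX, hG, fun i hi => ?_, fun i => ?_, fun i hi => ?_⟩
  · have := mul_nonneg hμ.le (hs0 i)
    simpa [hi] using this
  -- Only the first index of a block can be raised without breaking the order; γ = μ(s - 2σ)
  -- decreases along the block, so the bound at j covers every i in it.
  · obtain ⟨j, hj, hjmin⟩ := Finset.exists_min_image
      (Finset.univ.filter fun j => sv X j = sv X i) id ⟨i, by simp⟩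
    simp only [Finset.mem_filter, Finset.mem_univ, true_and, id] at hj hjmin
    refine ⟨j, hj, fun hw => ?_⟩
    have h := single_variation hmn hμ hfin hmin hX hG hw (τ := 1) (by norm_num) ?_
    · have hij := hjmin i rfl
      have := mul_le_mul_of_nonneg_left (hs hij) hμ.le
      simp only [hj] at h
      nlinarith
    · refine (eventually_all.mpr fun i' => ?_).and ((eventually_all.mpr fun i' => ?_).and ?_)
      · by_cases hi' : i' < j
        · have hlt : sv X j < sv X i' := lt_of_le_of_ne (sv_antitone X hi'.le) fun h =>
            absurd (hjmin i' (h ▸ hj)) (not_le.mpr hi')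
          filter_upwards [eventually_add_mul_le (τ := 1) hlt] with ε hε _ using hε
        · exact Eventually.of_forall fun _ h => absurd h hi'
      · filter_upwards [self_mem_nhdsWithin] with ε hε hi'
        have hε : 0 < ε := hε
        have := sv_antitone X hi'.le
        linarith
      · filter_upwards [self_mem_nhdsWithin] with ε hε
        have hε : 0 < ε := hε
        have := sv_nonneg X j
        linarith
  -- Dually, the last index of the block can be lowered, and there γ is smallest.
  · obtain ⟨j, hj, hjmax⟩ := Finset.exists_max_image
      (Finset.univ.filter fun j => sv X j = sv X i) id ⟨i, by simp⟩
    simp only [Finset.mem_filter, Finset.mem_univ, true_and, id] at hj hjmax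
    have hj0 : 0 < sv X j := hj ▸ hi
    have hw : w j ≠ ∞ := fun hw => hfin j (by
      rw [hw, ENNReal.top_mul]
      simpa using hj0)
    refine ⟨j, hj, ?_⟩
    have h := single_variation hmn hμ hfin hmin hX hG hw (τ := -1) (by norm_num) ?_
    · have hij := hjmax i rfl
      have := mul_le_mul_of_nonneg_left (hs hij) hμ.le
      simp only [hj] at h
      nlinarith
    · refine (eventually_all.mpr fun i' => ?_).and ((eventually_all.mpr fun i' => ?_).and ?_)
      · filter_upwards [self_mem_nhdsWithin] with ε hε hi'
        have hε : 0 < ε := hε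
        have := sv_antitone X hi'.le
        linarith
      · by_cases hi' : j < i'
        · have hlt : sv X i' < sv X j := lt_of_le_of_ne (sv_antitone X hi'.le) fun h =>
            absurd (hjmax i' (h ▸ hj)) (not_le.mpr hi')
          filter_upwards [eventually_le_add_mul (τ := -1) hlt] with ε hε _ using hε
        · exact Eventually.of_forall fun _ h => absurd h hi'
      · exact eventually_le_add_mul hj0

end Subproblem

/-! ### Concavity of the penalty. -/

section Penalty

variable {g : ℝ → ℝ}

/-- A concave function lies above its chord from the origin. -/
theorem IsPenalty.chord_le (hg : IsPenalty g) {x y : ℝ} (hx : 0 ≤ x) (hxy : x ≤ y) (hy : 0 < y) :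
    g 0 + (g y - g 0) / y * x ≤ g x := by
  have h1 : 0 ≤ 1 - x / y := sub_nonneg.mpr ((div_le_one hy).mpr hxy)
  have h2 : 0 ≤ x / y := by positivity
  have h := hg.concaveOn.2 (Set.mem_Ici.mpr (le_refl (0 : ℝ))) (Set.mem_Ici.mpr hy.le) h1 h2
    (sub_add_cancel _ _)
  have e : (1 - x / y) • (0 : ℝ) + (x / y) • y = x := by
    simp [hy.ne']
  rw [e] at h
  refine le_trans (le_of_eq ?_) h
  simp only [smul_eq_mul]
  ring

theorem IsPenalty.slope_le (hg : IsPenalty g) {x y : ℝ} (hx : 0 < x) (hxy : x ≤ y) :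
    (g y - g 0) / y ≤ (g x - g 0) / x := by
  rw [le_div_iff₀ hx]
  have := hg.chord_le hx.le hxy (hx.trans_le hxy)
  linarith

/-- The supergradient inequality, rearranged without subtraction so that it makes sense for v = ∞
and can pass to limits in [0,∞]. -/
theorem IsPenalty.le_of_mem_superdifferential (hg : IsPenalty g) {v : ℝ≥0∞} {θ y : ℝ}
    (hv : v ∈ superdifferential g θ) (hy : 0 ≤ y) :
    ENNReal.ofReal (g y) + v * ENNReal.ofReal θ ≤
      ENNReal.ofReal (g θ) + v * ENNReal.ofReal y := by
  rcases hv with ⟨hθ, hvt, hs⟩ | ⟨rfl, ht⟩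
  · have h := hs y hy
    have h0 : 0 ≤ v.toReal := ENNReal.toReal_nonneg
    rw [← ENNReal.ofReal_toReal hvt, ← ENNReal.ofReal_mul h0, ← ENNReal.ofReal_mul h0,
      ← ENNReal.ofReal_add (hg.nonneg y hy) (by positivity),
      ← ENNReal.ofReal_add (hg.nonneg θ hθ.le) (by positivity)]
    exact ENNReal.ofReal_le_ofReal (by linarith)
  · rcases hy.eq_or_lt with rfl | hy
    · exact le_rfl
    · have hle : ENNReal.ofReal ((g y - g 0) / y) ≤ v := by
        refine ge_of_tendsto ht ?_
        filter_upwards [Ioc_mem_nhdsGT hy] with x hx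
        exact ENNReal.ofReal_le_ofReal (hg.slope_le hx.1 hx.2)
      have h0 : 0 ≤ (g y - g 0) / y :=
        div_nonneg (sub_nonneg.mpr (hg.monotoneOn (Set.mem_Ici.mpr le_rfl)
          (Set.mem_Ici.mpr hy.le) hy.le)) hy.le
      rw [ENNReal.ofReal_zero, mul_zero, add_zero]
      calc ENNReal.ofReal (g y)
          = ENNReal.ofReal (g 0) + ENNReal.ofReal ((g y - g 0) / y) * ENNReal.ofReal y := by
            rw [← ENNReal.ofReal_mul h0,
              ← ENNReal.ofReal_add (hg.nonneg 0 le_rfl) (by positivity)]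
            congr 1
            field_simp
            ring
        _ ≤ _ := by gcongr

/-- This encodes v ≤ g'(0+): a supergradient at θ > 0 is at most the slope of the chord from 0 to θ,
and g lies above its chords. The conclusion does not involve θ, so it survives θ → 0. -/
theorem IsPenalty.exists_linear_le (hg : IsPenalty g) {v : ℝ≥0∞} {θ c : ℝ}
    (hv : v ∈ superdifferential g θ) (hc : ENNReal.ofReal c < v) :
    ∃ δ > 0, ∀ x, 0 ≤ x → x ≤ δ → g 0 + c * x ≤ g x := by
  suffices h : ∃ y > 0, c ≤ (g y - g 0) / y by
    obtain ⟨y, hy, hcy⟩ := h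
    refine ⟨y, hy, fun x hx hxy => ?_⟩
    have := hg.chord_le hx hxy hy
    nlinarith
  rcases hv with ⟨hθ, hvt, hs⟩ | ⟨rfl, ht⟩
  · refine ⟨θ, hθ, ?_⟩
    have h := hs 0 le_rfl
    have hc' : c < v.toReal := by
      rw [← ENNReal.ofReal_toReal hvt] at hc
      exact (ENNReal.ofReal_lt_ofReal_iff'.mp hc).1
    rw [le_div_iff₀ hθ]
    nlinarith
  · obtain ⟨y, h1, h2⟩ := ((ht.eventually_const_lt hc).and self_mem_nhdsWithin).exists
    exact ⟨y, h2, (ENNReal.ofReal_lt_ofReal_iff'.mp h1).1.le⟩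

end Penalty

/-! ### Quadratic bounds for the loss. -/

section Loss

variable {m n : ℕ} {f : Matrix (Fin m) (Fin n) ℝ → ℝ} {L : ℝ}

theorem fderiv_eq_frobInner (f : Matrix (Fin m) (Fin n) ℝ → ℝ) (X V : Matrix (Fin m) (Fin n) ℝ) :
    fderiv ℝ f X V = frobInner (matGrad f X) V := by
  conv_lhs => rw [Matrix.matrix_eq_sum_single V]
  rw [frobInner_eq_sum]
  simp only [map_sum, matGrad, Matrix.of_apply]
  refine Finset.sum_congr rfl fun i _ => Finset.sum_congr rfl fun j _ => ?_
  have : Matrix.single i j (V i j) = V i j • Matrix.single i j (1 : ℝ) := by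
    rw [Matrix.smul_single, smul_eq_mul, mul_one]
  rw [this, map_smul, smul_eq_mul, mul_comm]

/-- The descent lemma. -/
theorem IsLoss.le_quadratic (hf : IsLoss f L) (X Y : Matrix (Fin m) (Fin n) ℝ) :
    f Y ≤ f X + frobInner (matGrad f X) (Y - X) + L / 2 * ‖Y - X‖ ^ 2 := by
  set D := Y - X with hD
  -- Along the segment from X to Y the quadratic model is subtracted; the Lipschitz bound makes the
  -- derivative nonpositive.
  let h : ℝ → ℝ := fun t =>
    f (X + t • D) - t * frobInner (matGrad f X) D - L / 2 * t ^ 2 * ‖D‖ ^ 2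
  have hder : ∀ t, HasDerivAt h (frobInner (matGrad f (X + t • D)) D -
      frobInner (matGrad f X) D - L * t * ‖D‖ ^ 2) t := by
    intro t
    have h1 : HasDerivAt (fun t : ℝ => X + t • D) D t := by
      have := ((hasDerivAt_id t).smul_const D).const_add X
      rwa [one_smul] at this
    have h2 : HasDerivAt (fun t : ℝ => f (X + t • D))
        (frobInner (matGrad f (X + t • D)) D) t := by
      rw [← fderiv_eq_frobInner]
      exact (hf.differentiable (X + t • D)).hasFDerivAt.comp_hasDerivAt t h1
    have h3 := (h2.sub ((hasDerivAt_id t).mul_const (frobInner (matGrad f X) D))).sub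
      ((((hasDerivAt_id t).pow 2).const_mul (L / 2)).mul_const (‖D‖ ^ 2))
    convert! h3 using 1
    simp only [id_eq, Nat.cast_ofNat, Nat.add_one_sub_one, pow_one]
    ring
  have hanti : AntitoneOn h (Set.Icc 0 1) := by
    refine antitoneOn_of_deriv_nonpos (convex_Icc 0 1)
      (fun t _ => (hder t).continuousAt.continuousWithinAt)
      (fun t _ => (hder t).differentiableAt.differentiableWithinAt) fun t ht => ?_
    rw [interior_Icc] at ht
    rw [(hder t).deriv, ← frobInner_sub_left]
    have h1 := frobInner_le_norm_mul_norm (matGrad f (X + t • D) - matGrad f X) D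
    have h2 := hf.lipschitz (X + t • D) X
    rw [add_sub_cancel_left, norm_smul, Real.norm_of_nonneg ht.1.le] at h2
    have h3 := mul_le_mul_of_nonneg_right h2 (norm_nonneg D)
    nlinarith
  have h01 := hanti (Set.left_mem_Icc.mpr zero_le_one) (Set.right_mem_Icc.mpr zero_le_one)
    zero_le_one
  have hY : X + D = Y := by rw [hD]; abel
  simp only [h, one_smul, zero_smul, hY, add_zero] at h01
  linarith

theorem IsLoss.continuous_matGrad (hf : IsLoss f L) : Continuous (matGrad f) := by
  refine LipschitzWith.continuous (K := L.toNNReal) (LipschitzWith.of_dist_le_mul fun X Y => ?_)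
  rw [dist_eq_norm, dist_eq_norm, Real.coe_toNNReal _ hf.pos.le]
  exact hf.lipschitz X Y

end Loss

/-! ### Sufficient decrease and passage to the limit. -/

section Descent

variable {m n : ℕ} {g : ℝ → ℝ} {f : Matrix (Fin m) (Fin n) ℝ → ℝ} {L μ : ℝ}
  {X : ℕ → Matrix (Fin m) (Fin n) ℝ} {w : ℕ → Fin m → ℝ≥0∞}

theorem objective_nonneg (hg : IsPenalty g) (hf : IsLoss f L) (Y : Matrix (Fin m) (Fin n) ℝ) :
    0 ≤ objective g f Y :=
  add_nonneg (Finset.sum_nonneg fun i _ => hg.nonneg _ (sv_nonneg Y i)) (hf.nonneg Y)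

theorem continuous_penalty_sv (hmn : m ≤ n) (hg : IsPenalty g) (i : Fin m) :
    Continuous fun Y : Matrix (Fin m) (Fin n) ℝ => g (sv Y i) :=
  hg.continuousOn.comp_continuous (continuous_sv hmn i) fun Y => sv_nonneg Y i

theorem continuous_objective (hmn : m ≤ n) (hg : IsPenalty g) (hf : IsLoss f L) :
    Continuous (objective (m := m) (n := n) g f) :=
  (continuous_finsetSum _ fun i _ => continuous_penalty_sv hmn hg i).add
    hf.differentiable.continuous

/-- Majorization: supergradients bound the penalty from above, the descent lemma bounds the loss.
The indices start at k + 1 because w 0 is arbitrary. -/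
theorem IsIRNNSequence.sufficient_decrease (hg : IsPenalty g) (hf : IsLoss f L) (hμ : 0 < μ)
    (hX : IsIRNNSequence g f μ X w) (k : ℕ) :
    objective g f (X (k + 2)) + (μ - L) / 2 * ‖X (k + 2) - X (k + 1)‖ ^ 2 ≤
      objective g f (X (k + 1)) := by
  set A := X (k + 1) with hA
  set B := X (k + 2) with hB
  set W := w (k + 1) with hW
  set Z := A - μ⁻¹ • matGrad f A with hZ
  have hw : ∀ i, W i ∈ superdifferential g (sv A i) := hX.update_w k
  have h1 : ∑ i, W i * ENNReal.ofReal (sv B i) + ENNReal.ofReal (μ / 2 * ‖B - Z‖ ^ 2) ≤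
      ∑ i, W i * ENNReal.ofReal (sv A i) + ENNReal.ofReal (μ / 2 * ‖A - Z‖ ^ 2) :=
    hX.update_X (k + 1) A
  have h2 := Finset.sum_le_sum fun i (_ : i ∈ Finset.univ) =>
    hg.le_of_mem_superdifferential (hw i) (sv_nonneg B i)
  rw [Finset.sum_add_distrib, Finset.sum_add_distrib] at h2
  have hfin : ∑ i, W i * ENNReal.ofReal (sv A i) ≠ ∞ := by
    rw [ENNReal.sum_ne_top]
    intro i _
    rcases hw i with ⟨_, h, _⟩ | ⟨h, _⟩
    · exact ENNReal.mul_ne_top h ENNReal.ofReal_ne_top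
    · simp [h]
  have h3 : (∑ i, ENNReal.ofReal (g (sv B i)) + ENNReal.ofReal (μ / 2 * ‖B - Z‖ ^ 2)) +
      ∑ i, W i * ENNReal.ofReal (sv A i) ≤
      (∑ i, ENNReal.ofReal (g (sv A i)) + ENNReal.ofReal (μ / 2 * ‖A - Z‖ ^ 2)) +
      ∑ i, W i * ENNReal.ofReal (sv A i) := by
    calc _ = (∑ i, ENNReal.ofReal (g (sv B i)) + ∑ i, W i * ENNReal.ofReal (sv A i)) +
          ENNReal.ofReal (μ / 2 * ‖B - Z‖ ^ 2) := by ring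
      _ ≤ (∑ i, ENNReal.ofReal (g (sv A i)) + ∑ i, W i * ENNReal.ofReal (sv B i)) +
          ENNReal.ofReal (μ / 2 * ‖B - Z‖ ^ 2) := by gcongr
      _ = ∑ i, ENNReal.ofReal (g (sv A i)) + (∑ i, W i * ENNReal.ofReal (sv B i) +
          ENNReal.ofReal (μ / 2 * ‖B - Z‖ ^ 2)) := by ring
      _ ≤ ∑ i, ENNReal.ofReal (g (sv A i)) + (∑ i, W i * ENNReal.ofReal (sv A i) +
          ENNReal.ofReal (μ / 2 * ‖A - Z‖ ^ 2)) := by gcongr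
      _ = _ := by ring
  rw [ENNReal.add_le_add_iff_right hfin,
    ← ENNReal.ofReal_sum_of_nonneg fun i _ => hg.nonneg _ (sv_nonneg B i),
    ← ENNReal.ofReal_sum_of_nonneg fun i _ => hg.nonneg _ (sv_nonneg A i),
    ← ENNReal.ofReal_add (Finset.sum_nonneg fun i _ => hg.nonneg _ (sv_nonneg B i))
      (by positivity),
    ← ENNReal.ofReal_add (Finset.sum_nonneg fun i _ => hg.nonneg _ (sv_nonneg A i))
      (by positivity),
    ENNReal.ofReal_le_ofReal_iff (add_nonneg
      (Finset.sum_nonneg fun i _ => hg.nonneg _ (sv_nonneg A i)) (by positivity))] at h3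
  have h4 := hf.le_quadratic A B
  have e1 : B - Z = μ⁻¹ • matGrad f A + (B - A) := by rw [hZ]; abel
  have e2 : A - Z = μ⁻¹ • matGrad f A := by rw [hZ]; abel
  rw [e1, e2, norm_add_sq_frob, frobInner_smul_left] at h3
  have e3 : μ / 2 * (‖μ⁻¹ • matGrad f A‖ ^ 2 +
      2 * (μ⁻¹ * frobInner (matGrad f A) (B - A)) + ‖B - A‖ ^ 2) =
      μ / 2 * ‖μ⁻¹ • matGrad f A‖ ^ 2 + frobInner (matGrad f A) (B - A) +
        μ / 2 * ‖B - A‖ ^ 2 := by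
    field_simp
  rw [e3] at h3
  simp only [objective]
  linarith

theorem IsIRNNSequence.tendsto_sub (hg : IsPenalty g) (hf : IsLoss f L) (hμ : L < μ)
    (hX : IsIRNNSequence g f μ X w) :
    Tendsto (fun k => X (k + 1) - X k) atTop (𝓝 0) := by
  rw [← tendsto_add_atTop_iff_nat 1]
  have hdec := hX.sufficient_decrease hg hf (hf.pos.trans hμ)
  have hanti : Antitone fun k => objective g f (X (k + 1)) := by
    refine antitone_nat_of_succ_le fun k => ?_
    have := hdec k
    have h0 : 0 ≤ (μ - L) / 2 * ‖X (k + 2) - X (k + 1)‖ ^ 2 :=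
      mul_nonneg (by linarith) (sq_nonneg _)
    linarith
  have hlim := tendsto_atTop_ciInf hanti
    ⟨0, by rintro _ ⟨k, rfl⟩; exact objective_nonneg hg hf _⟩
  have hdiff := (hlim.sub ((tendsto_add_atTop_iff_nat 1).mpr hlim)).const_mul (2 / (μ - L))
  rw [sub_self, mul_zero] at hdiff
  have hsq : Tendsto (fun k => ‖X (k + 2) - X (k + 1)‖ ^ 2) atTop (𝓝 0) := by
    refine squeeze_zero (fun k => sq_nonneg _) (fun k => ?_) hdiff
    have := hdec k
    have hpos : 0 < μ - L := by linarith
    rw [div_mul_eq_mul_div, le_div_iff₀ hpos]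
    linarith
  refine tendsto_zero_iff_norm_tendsto_zero.mpr ?_
  have := hsq.sqrt
  simpa using this

/-- At a cluster point, the optimality of the iterates passes to the limit. -/
theorem IsIRNNSequence.exists_limit_weights (hmn : m ≤ n) (hg : IsPenalty g) (hf : IsLoss f L)
    (hμ : L < μ) (hX : IsIRNNSequence g f μ X w) {A : Matrix (Fin m) (Fin n) ℝ}
    (hA : MapClusterPt A atTop X) :
    ∃ v : Fin m → ℝ≥0∞,
      (∀ i, 0 < sv A i → v i ≠ ∞ ∧ IsSupergradient g (v i).toReal (sv A i)) ∧
      (∀ i c, ENNReal.ofReal c < v i → ∃ δ > 0, ∀ x, 0 ≤ x → x ≤ δ → g 0 + c * x ≤ g x) ∧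
      ∀ Y, subproblem μ v (A - μ⁻¹ • matGrad f A) A ≤
        subproblem μ v (A - μ⁻¹ • matGrad f A) Y := by
  -- Along an ultrafilter the weights converge in the compact space [0,∞]^m without extracting
  -- subsequences.
  obtain ⟨𝒰, h𝒰, hXA⟩ := mapClusterPt_iff_ultrafilter.mp hA
  have hw : Tendsto w 𝒰 (𝓝 (𝒰.map w).lim) := (𝒰.map w).le_nhds_lim
  set v := (𝒰.map w).lim
  have hwi : ∀ i, Tendsto (fun k => w k i) 𝒰 (𝓝 (v i)) := fun i => tendsto_pi_nhds.mp hw i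
  have hmem : ∀ᶠ k in (𝒰 : Filter ℕ), ∀ i, w k i ∈ superdifferential g (sv (X k) i) := by
    filter_upwards [h𝒰 (eventually_ge_atTop 1)] with k hk i
    obtain ⟨k, rfl⟩ := Nat.exists_eq_add_of_le' hk
    exact hX.update_w k i
  have hsv : ∀ i, Tendsto (fun k => sv (X k) i) 𝒰 (𝓝 (sv A i)) := fun i =>
    ((continuous_sv hmn i).tendsto A).comp hXA
  have hgsv : ∀ i, Tendsto (fun k => g (sv (X k) i)) 𝒰 (𝓝 (g (sv A i))) := fun i =>
    ((continuous_penalty_sv hmn hg i).tendsto A).comp hXA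
  have hle : ∀ i y, 0 < sv A i → 0 ≤ y → ENNReal.ofReal (g y) + v i * ENNReal.ofReal (sv A i) ≤
      ENNReal.ofReal (g (sv A i)) + v i * ENNReal.ofReal y := by
    intro i y hi hy
    have h0 : ENNReal.ofReal (sv A i) ≠ 0 := by simpa using hi
    refine le_of_tendsto_of_tendsto (tendsto_const_nhds.add (ENNReal.Tendsto.mul (hwi i)
      (Or.inr ENNReal.ofReal_ne_top) (ENNReal.tendsto_ofReal (hsv i)) (Or.inl h0)))
      ((ENNReal.tendsto_ofReal (hgsv i)).add
        (ENNReal.Tendsto.mul_const (hwi i) (Or.inr ENNReal.ofReal_ne_top))) ?_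
    filter_upwards [hmem] with k hk
    exact hg.le_of_mem_superdifferential (hk i) hy
  -- If v_i were infinite, the limiting inequality at y = 0 would bound ∞ · σ_i by g(σ_i).
  have hfin : ∀ i, 0 < sv A i → v i ≠ ∞ := by
    intro i hi hvi
    have := hle i 0 hi le_rfl
    rw [hvi, ENNReal.ofReal_zero, mul_zero, add_zero, ENNReal.top_mul (by simpa using hi),
      add_top, top_le_iff] at this
    exact ENNReal.ofReal_ne_top this
  refine ⟨v, fun i hi => ⟨hfin i hi, fun y hy => ?_⟩, fun i c hc => ?_, fun Y => ?_⟩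
  · have h := hle i y hi hy
    have h0 : 0 ≤ (v i).toReal := ENNReal.toReal_nonneg
    rw [← ENNReal.ofReal_toReal (hfin i hi), ← ENNReal.ofReal_mul h0, ← ENNReal.ofReal_mul h0,
      ← ENNReal.ofReal_add (hg.nonneg y hy) (by positivity),
      ← ENNReal.ofReal_add (hg.nonneg _ hi.le) (by positivity),
      ENNReal.ofReal_le_ofReal_iff (add_nonneg (hg.nonneg _ hi.le) (by positivity))] at h
    linarith
  · obtain ⟨k, h1, h2⟩ := (hmem.and ((hwi i).eventually_const_lt hc)).exists
    exact hg.exists_linear_le (h1 i) h2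
  · have hXA' : Tendsto (fun k => X (k + 1)) 𝒰 (𝓝 A) := by
      have := ((hX.tendsto_sub hg hf hμ).mono_left h𝒰).add hXA
      simpa using this
    have hsv' : ∀ i, Tendsto (fun k => sv (X (k + 1)) i) 𝒰 (𝓝 (sv A i)) := fun i =>
      ((continuous_sv hmn i).tendsto A).comp hXA'
    have hZ : Tendsto (fun k => X k - μ⁻¹ • matGrad f (X k)) 𝒰 (𝓝 (A - μ⁻¹ • matGrad f A)) :=
      hXA.sub (((hf.continuous_matGrad.tendsto A).comp hXA).const_smul μ⁻¹)
    have hquad : ∀ {Y' : ℕ → Matrix (Fin m) (Fin n) ℝ} {B}, Tendsto Y' 𝒰 (𝓝 B) →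
        Tendsto (fun k => ENNReal.ofReal (μ / 2 * ‖Y' k - (X k - μ⁻¹ • matGrad f (X k))‖ ^ 2)) 𝒰
          (𝓝 (ENNReal.ofReal (μ / 2 * ‖B - (A - μ⁻¹ • matGrad f A)‖ ^ 2))) := fun hY =>
      ENNReal.tendsto_ofReal (((hY.sub hZ).norm.pow 2).const_mul _)
    have hright : Tendsto (fun k => subproblem μ (w k) (X k - μ⁻¹ • matGrad f (X k)) Y) 𝒰
        (𝓝 (subproblem μ v (A - μ⁻¹ • matGrad f A) Y)) :=
      (tendsto_finsetSum _ fun i _ =>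
        ENNReal.Tendsto.mul_const (hwi i) (Or.inr ENNReal.ofReal_ne_top)).add
        (hquad tendsto_const_nhds)
    -- Where σ_i(A) = 0 the products may be of the form ∞ · 0 in the limit; these terms are dropped,
    -- which is harmless as only a lower bound is needed here.
    have hleft : Tendsto (fun k => ∑ i, (if 0 < sv A i then
        w k i * ENNReal.ofReal (sv (X (k + 1)) i) else 0) +
        ENNReal.ofReal (μ / 2 * ‖X (k + 1) - (X k - μ⁻¹ • matGrad f (X k))‖ ^ 2)) 𝒰
        (𝓝 (subproblem μ v (A - μ⁻¹ • matGrad f A) A)) := by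
      refine Tendsto.add (tendsto_finsetSum _ fun i _ => ?_) (hquad hXA')
      split_ifs with hi
      · exact ENNReal.Tendsto.mul (hwi i) (Or.inr ENNReal.ofReal_ne_top)
          (ENNReal.tendsto_ofReal (hsv' i)) (Or.inr (hfin i hi))
      · rw [le_antisymm (not_lt.mp hi) (sv_nonneg A i), ENNReal.ofReal_zero, mul_zero]
        exact tendsto_const_nhds
    refine le_of_tendsto_of_tendsto hleft hright (Eventually.of_forall fun k => ?_)
    refine le_trans ?_ (hX.update_X k Y)
    refine add_le_add (Finset.sum_le_sum fun i _ => ?_) le_rfl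
    split_ifs
    · exact le_rfl
    · exact zero_le

end Descent

/-! ### Upper bound for the penalty. -/

section Peierls

variable {m n : ℕ} {g : ℝ → ℝ}

/-- Peierls' inequality for a positive semidefinite matrix in an orthonormal frame. -/
theorem sum_penalty_sv_le_of_posSemidef (hmn : m ≤ n) (hg : IsPenalty g)
    {U : Matrix (Fin m) (Fin m) ℝ} {V : Matrix (Fin n) (Fin m) ℝ} (hU : Uᵀ * U = 1)
    (hV : Vᵀ * V = 1) {T : Matrix (Fin m) (Fin m) ℝ} (hT : T.PosSemidef) :
    ∑ i, g (sv (U * T * Vᵀ) i) ≤ ∑ i, g (T i i) := by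
  set E : Matrix (Fin m) (Fin m) ℝ :=
    hT.isHermitian.eigenvectorUnitary.1 with hE
  set l := hT.isHermitian.eigenvalues with hl
  have hl0 : ∀ i, 0 ≤ l i := hT.eigenvalues_nonneg
  have hEE : Eᵀ * E = 1 := by
    have := Unitary.coe_star_mul_self hT.isHermitian.eigenvectorUnitary
    rwa [Matrix.star_eq_conjTranspose, Matrix.conjTranspose_eq_transpose_of_trivial] at this
  have hspec : T = E * Matrix.diagonal l * Eᵀ := by
    have := hT.isHermitian.spectral_theorem
    rw [Unitary.conjStarAlgAut_apply, Matrix.star_eq_conjTranspose,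
      Matrix.conjTranspose_eq_transpose_of_trivial] at this
    exact this
  have hEE' : E * Eᵀ = 1 := mul_eq_one_comm.mp hEE
  have hsvd : IsSVD (U * T * Vᵀ) (U * E) (V * E) l := by
    refine ⟨?_, ?_, ?_, hl0⟩
    · rw [Matrix.transpose_mul, Matrix.mul_assoc, ← Matrix.mul_assoc Uᵀ, hU, Matrix.one_mul, hEE]
    · rw [Matrix.transpose_mul, Matrix.mul_assoc, ← Matrix.mul_assoc Vᵀ, hV, Matrix.one_mul, hEE]
    · conv_lhs => rw [hspec]
      simp only [Matrix.transpose_mul, Matrix.mul_assoc]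
  obtain ⟨π, hπ⟩ := hsvd.exists_perm hmn
  have h1 : ∑ i, g (sv (U * T * Vᵀ) i) = ∑ a, g (l a) := by
    rw [hπ]
    exact Equiv.sum_comp π fun a => g (l a)
  have hdiag : ∀ i, T i i = ∑ a, E i a ^ 2 * l a := by
    intro i
    conv_lhs => rw [hspec, Matrix.mul_apply]
    refine Finset.sum_congr rfl fun a _ => ?_
    rw [Matrix.mul_diagonal, Matrix.transpose_apply]
    ring
  have hrow : ∀ i, ∑ a, E i a ^ 2 = 1 := by
    intro i
    have := congrFun (congrFun hEE' i) i
    simpa [Matrix.mul_apply, pow_two] using this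
  have hcol : ∀ a, ∑ i, E i a ^ 2 = 1 := by
    intro a
    have := congrFun (congrFun hEE a) a
    simpa [Matrix.mul_apply, pow_two] using this
  -- T_ii averages the eigenvalues with weights E_ia², which also sum to 1 over i; Jensen applies
  -- for each i.
  have hjensen : ∀ i, ∑ a, E i a ^ 2 * g (l a) ≤ g (T i i) := by
    intro i
    rw [hdiag]
    have := hg.concaveOn.le_map_sum (t := Finset.univ) (w := fun a => E i a ^ 2) (p := l)
      (fun a _ => sq_nonneg _) (hrow i) (fun a _ => hl0 a)
    simpa only [smul_eq_mul] using this
  rw [h1]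
  calc ∑ a, g (l a) = ∑ a, ∑ i, E i a ^ 2 * g (l a) := by
        simp only [← Finset.sum_mul, hcol, one_mul]
    _ = ∑ i, ∑ a, E i a ^ 2 * g (l a) := Finset.sum_comm
    _ ≤ _ := Finset.sum_le_sum fun i _ => hjensen i

theorem exists_pos_le_of_pos (σ : Fin m → ℝ) : ∃ ρ > 0, ∀ i, 0 < σ i → ρ ≤ σ i := by
  have h : ∀ᶠ ρ in 𝓝[>] (0 : ℝ), ∀ i, 0 < σ i → ρ ≤ σ i := by
    refine eventually_all.mpr fun i => ?_
    by_cases hi : 0 < σ i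
    · filter_upwards [Ioc_mem_nhdsGT hi] with ρ hρ _ using hρ.2
    · exact Eventually.of_forall fun _ h => absurd h hi
  obtain ⟨ρ, h1, h2⟩ := (h.and self_mem_nhdsWithin).exists
  exact ⟨ρ, h2, h1⟩

/-- S lives on the block where diag(σ) is at least some ρ > 0, so a small multiple of S is dominated
there. -/
theorem posSemidef_diagonal_sub_smul {σ : Fin m → ℝ} (hσ : ∀ i, 0 ≤ σ i)
    {S : Matrix (Fin m) (Fin m) ℝ} (hS : Sᵀ = S)
    (hS0 : ∀ i j, ¬ (0 < σ i ∧ 0 < σ j) → S i j = 0) :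
    ∀ᶠ t in 𝓝[>] (0 : ℝ), (Matrix.diagonal σ - t • S).PosSemidef := by
  obtain ⟨ρ, hρ, hρσ⟩ := exists_pos_le_of_pos σ
  set C := ∑ i, ∑ j, |S i j| with hC
  have hC0 : 0 ≤ C := Finset.sum_nonneg fun i _ => Finset.sum_nonneg fun j _ => abs_nonneg _
  have ht : ∀ᶠ t in 𝓝[>] (0 : ℝ), 0 + C * t ≤ ρ := eventually_add_mul_le hρ
  filter_upwards [ht, self_mem_nhdsWithin] with t ht ht0
  have ht0 : 0 < t := ht0
  refine Matrix.PosSemidef.of_dotProduct_mulVec_nonneg ?_ fun x => ?_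
  · rw [Matrix.IsHermitian, Matrix.conjTranspose_eq_transpose_of_trivial, Matrix.transpose_sub,
      Matrix.transpose_smul, hS, Matrix.diagonal_transpose]
  · rw [star_trivial, Matrix.sub_mulVec, dotProduct_sub, Matrix.smul_mulVec, dotProduct_smul,
      smul_eq_mul]
    set y : Fin m → ℝ := fun i => if 0 < σ i then x i ^ 2 else 0 with hy
    have hy0 : ∀ i, 0 ≤ y i := fun i => by simp only [hy]; split_ifs <;> positivity
    set P := ∑ i, y i with hP
    have hP0 : 0 ≤ P := Finset.sum_nonneg fun i _ => hy0 i
    have h1 : ρ * P ≤ x ⬝ᵥ (Matrix.diagonal σ *ᵥ x) := by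
      rw [hP, Finset.mul_sum, dotProduct]
      refine Finset.sum_le_sum fun i _ => ?_
      rw [Matrix.mulVec_diagonal]
      simp only [hy]
      split_ifs with hi
      · nlinarith [hρσ i hi, sq_nonneg (x i)]
      · have := mul_nonneg (hσ i) (sq_nonneg (x i))
        nlinarith
    have h2 : x ⬝ᵥ (S *ᵥ x) ≤ C * P := by
      rw [hC, Finset.sum_mul, dotProduct]
      refine Finset.sum_le_sum fun i _ => ?_
      rw [Finset.sum_mul, Matrix.mulVec, dotProduct, Finset.mul_sum]
      refine Finset.sum_le_sum fun j _ => ?_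
      by_cases hij : 0 < σ i ∧ 0 < σ j
      · have e1 : x i ^ 2 ≤ P := by
          have := Finset.single_le_sum (fun i _ => hy0 i) (Finset.mem_univ i)
          simpa [hy, hij.1] using this
        have e2 : x j ^ 2 ≤ P := by
          have := Finset.single_le_sum (fun i _ => hy0 i) (Finset.mem_univ j)
          simpa [hy, hij.2] using this
        have e3 : |x i * x j| ≤ P := by
          rw [abs_le]
          constructor <;> nlinarith [sq_nonneg (x i - x j), sq_nonneg (x i + x j)]
        calc x i * (S i j * x j) = S i j * (x i * x j) := by ring
          _ ≤ |S i j * (x i * x j)| := le_abs_self _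
          _ = |S i j| * |x i * x j| := abs_mul _ _
          _ ≤ |S i j| * P := mul_le_mul_of_nonneg_left e3 (abs_nonneg _)
      · rw [hS0 i j hij]
        simp
    have h3 := mul_le_mul_of_nonneg_left h2 ht0.le
    have h4 := mul_le_mul_of_nonneg_right ht hP0
    nlinarith

/-- Upper bound for the penalty after a symmetric perturbation of the block of positive singular
values. -/
theorem eventually_sum_penalty_sv_le (hmn : m ≤ n) (hg : IsPenalty g)
    {A : Matrix (Fin m) (Fin n) ℝ} {U : Matrix (Fin m) (Fin m) ℝ} {V : Matrix (Fin n) (Fin m) ℝ}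
    (hA : IsSVD A U V (sv A)) {γ : Fin m → ℝ}
    (hγ : ∀ i, 0 < sv A i → IsSupergradient g (γ i) (sv A i))
    {S : Matrix (Fin m) (Fin m) ℝ} (hS : Sᵀ = S)
    (hS0 : ∀ i j, ¬ (0 < sv A i ∧ 0 < sv A j) → S i j = 0) :
    ∀ᶠ t in 𝓝[>] (0 : ℝ), ∑ i, g (sv (A - t • (U * S * Vᵀ)) i) ≤
      ∑ i, g (sv A i) - t * ∑ i, γ i * S i i := by
  filter_upwards [posSemidef_diagonal_sub_smul (sv_nonneg A) hS hS0] with t ht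
  have e : A - t • (U * S * Vᵀ) = U * (Matrix.diagonal (sv A) - t • S) * Vᵀ := by
    rw [Matrix.mul_sub, Matrix.sub_mul, ← hA.eq, Matrix.mul_smul, Matrix.smul_mul]
  rw [e]
  refine (sum_penalty_sv_le_of_posSemidef hmn hg hA.left hA.right ht).trans ?_
  rw [Finset.mul_sum, ← Finset.sum_sub_distrib]
  refine Finset.sum_le_sum fun i _ => ?_
  have hii : 0 ≤ (Matrix.diagonal (sv A) - t • S) i i := ht.diag_nonneg
  simp only [Matrix.sub_apply, Matrix.diagonal_apply_eq, Matrix.smul_apply, smul_eq_mul] at hii ⊢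
  by_cases hi : 0 < sv A i
  · have := hγ i hi _ hii
    linarith
  · rw [hS0 i i fun h => hi h.1]
    simp

end Peierls

/-! ### Lower bound for the penalty. -/

section LowerBound

variable {m n : ℕ} {g : ℝ → ℝ}

/-- A perturbation that is skew-symmetric on the block of positive singular values does not
decrease these to first order. -/
theorem sv_le_sv_add_of_skew (hmn : m ≤ n) {A : Matrix (Fin m) (Fin n) ℝ}
    {U : Matrix (Fin m) (Fin m) ℝ} {V : Matrix (Fin n) (Fin m) ℝ} (hA : IsSVD A U V (sv A))
    {R : Matrix (Fin m) (Fin n) ℝ}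
    (hR : ∀ i j, 0 < sv A i → 0 < sv A j → (Uᵀ * R * V) i j + (Uᵀ * R * V) j i = 0)
    (t : ℝ) {i : Fin m} (hi : 0 < sv A i) : sv A i ≤ sv (A + t • R) i := by
  refine le_sv_of_compression hmn _ hA.left hA.right i _ fun x hx => ?_
  set B := Uᵀ * R * V with hB
  have e : Uᵀ * (A + t • R) * V = Matrix.diagonal (sv A) + t • B := by
    rw [Matrix.mul_add, Matrix.add_mul, hA.transpose_mul_mul, Matrix.mul_smul, Matrix.smul_mul]
  -- The test vectors are supported on the first indices up to i, all in the positive block, where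
  -- the quadratic form of a skew matrix vanishes.
  have hskew : x ⬝ᵥ (B *ᵥ x) = 0 := by
    have h1 : x ⬝ᵥ (B *ᵥ x) = ∑ a, ∑ b, x a * x b * B a b := by
      simp only [dotProduct, Matrix.mulVec, Finset.mul_sum]
      exact Finset.sum_congr rfl fun a _ => Finset.sum_congr rfl fun b _ => by ring
    have h2 : x ⬝ᵥ (B *ᵥ x) = ∑ a, ∑ b, x a * x b * B b a := by
      rw [h1, Finset.sum_comm]
      exact Finset.sum_congr rfl fun a _ => Finset.sum_congr rfl fun b _ => by ring
    have h3 : x ⬝ᵥ (B *ᵥ x) + x ⬝ᵥ (B *ᵥ x) = 0 := by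
      conv_lhs => rw [h2]
      rw [← h2]
      nth_rewrite 1 [h1]
      rw [h2, ← Finset.sum_add_distrib]
      refine Finset.sum_eq_zero fun a _ => ?_
      rw [← Finset.sum_add_distrib]
      refine Finset.sum_eq_zero fun b _ => ?_
      rw [← mul_add]
      by_cases ha : i < a
      · rw [hx a ha]; ring
      · by_cases hb : i < b
        · rw [hx b hb]; ring
        · rw [hR a b (hi.trans_le (sv_antitone A (not_lt.mp ha)))
            (hi.trans_le (sv_antitone A (not_lt.mp hb))), mul_zero]
    linarith
  rw [e, Matrix.add_mulVec, dotProduct_add, Matrix.smul_mulVec, dotProduct_smul, hskew,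
    smul_zero, add_zero]
  simp only [dotProduct, Matrix.mulVec_diagonal, Finset.mul_sum]
  refine Finset.sum_le_sum fun j _ => ?_
  by_cases hj : i < j
  · rw [hx j hj]; simp
  · have := mul_le_mul_of_nonneg_right (sv_antitone A (not_lt.mp hj)) (mul_self_nonneg (x j))
    linarith

variable {A R : Matrix (Fin m) (Fin n) ℝ} {U : Matrix (Fin m) (Fin m) ℝ}
  {V : Matrix (Fin n) (Fin m) ℝ} {Q : ℕ → Matrix (Fin m) (Fin n) ℝ} {t : ℕ → ℝ}

theorem sv_sub_le_of_skew (hmn : m ≤ n) (hA : IsSVD A U V (sv A))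
    (hR : ∀ i j, 0 < sv A i → 0 < sv A j → (Uᵀ * R * V) i j + (Uᵀ * R * V) j i = 0)
    {s : ℝ} (hs : 0 ≤ s) (R' : Matrix (Fin m) (Fin n) ℝ) {i : Fin m} (hi : 0 < sv A i) :
    sv A i - s * ‖R' - R‖ ≤ sv (A + s • R') i := by
  have h1 := sv_le_sv_add_of_skew hmn hA hR s hi
  have h2 := abs_sv_sub_le hmn (A + s • R') (A + s • R) i
  have h3 : A + s • R' - (A + s • R) = s • (R' - R) := by rw [smul_sub]; abel
  rw [h3, norm_smul, Real.norm_of_nonneg hs] at h2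
  have := (abs_le.mp h2).1
  linarith

theorem frobInner_eq_zero_of_skew (hA : IsSVD A U V (sv A))
    (hR : ∀ i j, 0 < sv A i → 0 < sv A j → (Uᵀ * R * V) i j + (Uᵀ * R * V) j i = 0) :
    frobInner A R = 0 := by
  conv_lhs => rw [hA.eq]
  rw [frobInner_mul_mul, frobInner_diagonal]
  refine Finset.sum_eq_zero fun i _ => ?_
  by_cases hi : 0 < sv A i
  · have := hR i i hi hi
    rw [show (Uᵀ * R * V) i i = 0 by linarith, mul_zero]
  · rw [le_antisymm (not_lt.mp hi) (sv_nonneg A i), zero_mul]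

/-- The positive singular values do not change to first order under such a perturbation. -/
theorem tendsto_sv_slope_of_skew (hmn : m ≤ n) (hA : IsSVD A U V (sv A))
    (hR : ∀ i j, 0 < sv A i → 0 < sv A j → (Uᵀ * R * V) i j + (Uᵀ * R * V) j i = 0)
    (hQ : Tendsto Q atTop (𝓝 R)) (ht0 : ∀ k, 0 < t k) (ht : Tendsto t atTop (𝓝 0))
    {i : Fin m} (hi : 0 < sv A i) :
    Tendsto (fun k => (sv (A + t k • Q k) i - sv A i) / t k) atTop (𝓝 0) := by
  have he : Tendsto (fun k => ‖Q k - R‖) atTop (𝓝 0) := by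
    have := (hQ.sub_const R).norm
    rwa [sub_self, norm_zero] at this
  have hAQ : Tendsto (fun k => frobInner A (Q k)) atTop (𝓝 0) := by
    rw [← frobInner_eq_zero_of_skew hA hR]
    exact tendsto_frobInner tendsto_const_nhds hQ
  -- Each slope is already bounded below by -‖Q k - R‖. The upper bound comes from the sum of
  -- squares ‖A + tQ‖², whose first-order change 2t⟨A, R⟩ is zero: a sum of nonnegative terms that
  -- is small has small terms.
  have hup : Tendsto (fun k => 2 * frobInner A (Q k) + t k * ‖Q k‖ ^ 2 +
      2 * ‖Q k - R‖ * ∑ j, sv A j) atTop (𝓝 0) := by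
    have := ((hAQ.const_mul 2).add (ht.mul (hQ.norm.pow 2))).add
      ((he.const_mul 2).mul_const (∑ j, sv A j))
    simpa using this
  have hterm : ∀ k j, 0 ≤ 2 * sv A j * (sv (A + t k • Q k) j - sv A j + t k * ‖Q k - R‖) := by
    intro k j
    by_cases hj : 0 < sv A j
    · have := sv_sub_le_of_skew hmn hA hR (ht0 k).le (Q k) hj
      exact mul_nonneg (by linarith) (by linarith)
    · rw [le_antisymm (not_lt.mp hj) (sv_nonneg A j)]
      simp
  have hsum : ∀ k, ∑ j, 2 * sv A j * (sv (A + t k • Q k) j - sv A j + t k * ‖Q k - R‖) ≤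
      t k * (2 * frobInner A (Q k) + t k * ‖Q k‖ ^ 2 + 2 * ‖Q k - R‖ * ∑ j, sv A j) := by
    intro k
    obtain ⟨U', V', hM⟩ := exists_isSVD hmn (A + t k • Q k)
    have h1 := hM.norm_sq
    rw [norm_add_sq_frob, hA.norm_sq, frobInner_smul_right, norm_smul,
      Real.norm_of_nonneg (ht0 k).le] at h1
    have h2 : ∑ j, 2 * sv A j * (sv (A + t k • Q k) j - sv A j + t k * ‖Q k - R‖) ≤
        ∑ j, sv (A + t k • Q k) j ^ 2 - ∑ j, sv A j ^ 2 +
          2 * t k * ‖Q k - R‖ * ∑ j, sv A j := by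
      rw [Finset.mul_sum, ← Finset.sum_sub_distrib, ← Finset.sum_add_distrib]
      refine Finset.sum_le_sum fun j _ => ?_
      nlinarith [sq_nonneg (sv (A + t k • Q k) j - sv A j)]
    nlinarith
  have hδ : Tendsto (fun k => (sv (A + t k • Q k) i - sv A i) / t k + ‖Q k - R‖) atTop (𝓝 0) := by
    have hup' := hup.div_const (2 * sv A i)
    rw [zero_div] at hup'
    refine squeeze_zero (fun k => ?_) (fun k => ?_) hup'
    · have := sv_sub_le_of_skew hmn hA hR (ht0 k).le (Q k) hi
      have h : 0 ≤ (sv (A + t k • Q k) i - sv A i + t k * ‖Q k - R‖) / t k :=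
        div_nonneg (by linarith) (ht0 k).le
      rwa [add_div, mul_div_cancel_left₀ _ (ht0 k).ne'] at h
    · rw [le_div_iff₀ (by linarith)]
      have h1 := (Finset.single_le_sum (fun j _ => hterm k j) (Finset.mem_univ i)).trans (hsum k)
      refine le_of_mul_le_mul_left (le_trans (le_of_eq ?_) h1) (ht0 k)
      have := (ht0 k).ne'
      field_simp
  have := hδ.sub he
  simpa using this

/-- First-order lower bound for the penalty under a perturbation that is skew-symmetric on the
block of positive singular values. -/
theorem exists_penalty_lower_bound (hmn : m ≤ n) (hg : IsPenalty g) (hA : IsSVD A U V (sv A))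
    (hR : ∀ i j, 0 < sv A i → 0 < sv A j → (Uᵀ * R * V) i j + (Uᵀ * R * V) j i = 0)
    (hQ : Tendsto Q atTop (𝓝 R)) (ht0 : ∀ k, 0 < t k) (ht : Tendsto t atTop (𝓝 0))
    {γ : Fin m → ℝ} {κ η δ : ℝ} (hγ0 : ∀ i, sv A i = 0 → 0 ≤ γ i)
    (hγκ : ∀ i, sv A i = 0 → γ i ≤ κ) (hκ : 0 ≤ κ) (hη : 0 ≤ η) (hδ : 0 < δ)
    (hδg : ∀ x, 0 ≤ x → x ≤ δ → g 0 + η * κ * x ≤ g x) :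
    ∃ b : ℕ → ℝ, Tendsto b atTop (𝓝 (η * ∑ i, γ i * (Uᵀ * R * V) i i)) ∧
      ∀ᶠ k in atTop, ∑ i, g (sv A i) + t k * b k ≤ ∑ i, g (sv (A + t k • Q k) i) := by
  -- Dual certificate for the nuclear norm. If κ = 0, then γ vanishes on the zero block,
  -- consistently with division by zero.
  set c : Fin m → ℝ := fun i => if 0 < sv A i then 1 else γ i / κ with hc
  have hzero : ∀ i, ¬ 0 < sv A i → sv A i = 0 := fun i hi =>
    le_antisymm (not_lt.mp hi) (sv_nonneg A i)
  have hc0 : ∀ i, 0 ≤ c i := fun i => by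
    simp only [hc]
    split_ifs with hi
    · exact zero_le_one
    · exact div_nonneg (hγ0 i (hzero i hi)) hκ
  have hc1 : ∀ i, c i ≤ 1 := fun i => by
    simp only [hc]
    split_ifs with hi
    · exact le_rfl
    · exact div_le_one_of_le₀ (hγκ i (hzero i hi)) hκ
  set D : ℕ → Fin m → ℝ := fun k i =>
    if 0 < sv A i then (sv (A + t k • Q k) i - sv A i) / t k else 0 with hD
  have hDlim : ∀ i, Tendsto (fun k => D k i) atTop (𝓝 0) := fun i => by
    simp only [hD]
    split_ifs with hi
    · exact tendsto_sv_slope_of_skew hmn hA hR hQ ht0 ht hi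
    · exact tendsto_const_nhds
  have he : Tendsto (fun k => ‖Q k - R‖) atTop (𝓝 0) := by
    have := (hQ.sub_const R).norm
    rwa [sub_self, norm_zero] at this
  have hB : ∀ i, Tendsto (fun k => (Uᵀ * Q k * V) i i) atTop (𝓝 ((Uᵀ * R * V) i i)) := by
    intro i
    have hcont : Continuous fun W : Matrix (Fin m) (Fin n) ℝ => (Uᵀ * W * V) i i := by fun_prop
    exact (hcont.tendsto R).comp hQ
  have hM : Tendsto (fun k => A + t k • Q k) atTop (𝓝 A) := by
    have := (ht.smul hQ).const_add A
    rwa [zero_smul, add_zero] at this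
  refine ⟨fun k => η * κ * ∑ i, (c i * (Uᵀ * Q k * V) i i - D k i) -
    ‖Q k - R‖ * ∑ i, g (sv A i) / sv A i, ?_, ?_⟩
  · have hlim := ((tendsto_finsetSum Finset.univ fun i _ =>
      ((hB i).const_mul (c i)).sub (hDlim i)).const_mul (η * κ)).sub
      (he.mul_const (∑ i, g (sv A i) / sv A i))
    convert! hlim using 2
    rw [zero_mul, sub_zero, mul_assoc, Finset.mul_sum Finset.univ _ κ]
    congr 1
    refine Finset.sum_congr rfl fun i _ => ?_
    rw [sub_zero]
    by_cases hi : 0 < sv A i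
    · have := hR i i hi hi
      rw [show (Uᵀ * R * V) i i = 0 by linarith]
      simp
    · simp only [hc, if_neg hi]
      rcases hκ.eq_or_lt with h0 | hpos
      · have : γ i = 0 := le_antisymm (h0 ▸ hγκ i (hzero i hi)) (hγ0 i (hzero i hi))
        simp [this]
      · field_simp
  · have hsmall : ∀ᶠ k in atTop, ∀ i, sv A i = 0 → sv (A + t k • Q k) i ≤ δ := by
      refine eventually_all.mpr fun i => ?_
      by_cases hi : sv A i = 0
      · have h := ((continuous_sv hmn i).tendsto A).comp hM
        simp only [hi] at h
        filter_upwards [h.eventually_lt_const hδ] with k hk _ using hk.le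
      · exact Eventually.of_forall fun _ h => absurd h hi
    have hte : ∀ᶠ k in atTop, ∀ i, 0 < sv A i → t k * ‖Q k - R‖ ≤ sv A i := by
      refine eventually_all.mpr fun i => ?_
      by_cases hi : 0 < sv A i
      · have h := ht.mul he
        rw [mul_zero] at h
        filter_upwards [h.eventually_lt_const hi] with k hk _ using hk.le
      · exact Eventually.of_forall fun _ h => absurd h hi
    filter_upwards [hsmall, hte] with k hk1 hk2
    have ht0' := ht0 k
    set M := A + t k • Q k with hMdef
    -- For σ_i > 0 the chord from 0 costs only a multiple of t‖Q - R‖ = o(t); for σ_i = 0 the linear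
    -- bound near 0 applies.
    have hterm : ∀ i, g (sv A i) + (η * κ * (if 0 < sv A i then 0 else sv M i) -
        t k * ‖Q k - R‖ * (g (sv A i) / sv A i)) ≤ g (sv M i) := by
      intro i
      split_ifs with hi
      · have h1 := sv_sub_le_of_skew hmn hA hR ht0'.le (Q k) hi
        have h2 : 0 ≤ sv A i - t k * ‖Q k - R‖ := by linarith [hk2 i hi]
        have h3 := hg.monotoneOn (Set.mem_Ici.mpr h2) (Set.mem_Ici.mpr (sv_nonneg M i)) h1
        have h4 := hg.chord_le h2 (sub_le_self _ (by positivity)) hi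
        refine le_trans ?_ (h4.trans h3)
        have h5 : 0 ≤ t k * ‖Q k - R‖ * (g 0 / sv A i) :=
          mul_nonneg (by positivity) (div_nonneg (hg.nonneg 0 le_rfl) hi.le)
        have h6 : g 0 + (g (sv A i) - g 0) / sv A i * (sv A i - t k * ‖Q k - R‖) =
            g (sv A i) - t k * ‖Q k - R‖ * (g (sv A i) / sv A i) +
              t k * ‖Q k - R‖ * (g 0 / sv A i) := by
          field_simp
          ring
        rw [h6]
        linarith
      · have h := hδg (sv M i) (sv_nonneg M i) (hk1 i (hzero i hi))
        rw [hzero i hi]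
        simpa using h
    have hsum := Finset.sum_le_sum fun i (_ : i ∈ Finset.univ) => hterm i
    rw [Finset.sum_add_distrib, Finset.sum_sub_distrib, ← Finset.mul_sum, ← Finset.mul_sum] at hsum
    -- Duality bounds the sum of all singular values of M from below; removing the positive ones,
    -- known to first order, leaves the zero block.
    have hnuc := sum_mul_diag_le_sum_sv hmn M hA.left hA.right c hc0 hc1
    have hdiag : ∀ i, c i * (Uᵀ * M * V) i i = (if 0 < sv A i then sv A i else 0) +
        t k * (c i * (Uᵀ * Q k * V) i i) := by
      intro i
      have e : Uᵀ * M * V = Matrix.diagonal (sv A) + t k • (Uᵀ * Q k * V) := by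
        rw [hMdef, Matrix.mul_add, Matrix.add_mul, hA.transpose_mul_mul, Matrix.mul_smul,
          Matrix.smul_mul]
      rw [e, Matrix.add_apply, Matrix.diagonal_apply_eq, Matrix.smul_apply, smul_eq_mul]
      by_cases hi : 0 < sv A i
      · simp only [hc, if_pos hi]
        ring
      · rw [hzero i hi]
        simp
        ring
    have hsplit : ∀ i, sv M i = (if 0 < sv A i then 0 else sv M i) +
        ((if 0 < sv A i then sv A i else 0) + t k * D k i) := by
      intro i
      simp only [hD]
      split_ifs
      · field_simp
        ring
      · ring
    rw [Finset.sum_congr rfl fun i _ => hdiag i, Finset.sum_congr rfl fun i _ => hsplit i,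
      Finset.sum_add_distrib, Finset.sum_add_distrib, Finset.sum_add_distrib, ← Finset.mul_sum,
      ← Finset.mul_sum] at hnuc
    have hmul := mul_le_mul_of_nonneg_left hnuc (mul_nonneg hη hκ)
    rw [Finset.sum_sub_distrib]
    nlinarith

end LowerBound

/-! ### Clarke tangents of the epigraph. -/

section Stationary

variable {m n : ℕ} {g : ℝ → ℝ} {f : Matrix (Fin m) (Fin n) ℝ → ℝ} {L : ℝ}

theorem IsLoss.quadratic_le (hf : IsLoss f L) (X Y : Matrix (Fin m) (Fin n) ℝ) :
    f X + frobInner (matGrad f Y) (Y - X) - L / 2 * ‖Y - X‖ ^ 2 ≤ f Y := by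
  have h := hf.le_quadratic Y X
  rw [← neg_sub Y X, norm_neg, ← neg_one_smul ℝ (Y - X), frobInner_smul_right] at h
  linarith

/-- A tangent direction of the epigraph of the objective has nonnegative last component, up to an
arbitrarily small error. -/
theorem tangent_lower_bound (hmn : m ≤ n) (hg : IsPenalty g) (hf : IsLoss f L)
    {A : Matrix (Fin m) (Fin n) ℝ} {U : Matrix (Fin m) (Fin m) ℝ} {V : Matrix (Fin n) (Fin m) ℝ}
    {γ : Fin m → ℝ} (hA : IsSVD A U V (sv A))
    (hG : -matGrad f A = U * Matrix.diagonal γ * Vᵀ)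
    (hγ : ∀ i, 0 < sv A i → IsSupergradient g (γ i) (sv A i))
    {κ η δ : ℝ} (hγ0 : ∀ i, sv A i = 0 → 0 ≤ γ i)
    (hγκ : ∀ i, sv A i = 0 → γ i ≤ κ) (hκ : 0 ≤ κ) (hη : 0 ≤ η) (hδ : 0 < δ)
    (hδg : ∀ x, 0 ≤ x → x ≤ δ → g 0 + η * κ * x ≤ g x)
    {D : Matrix (Fin m) (Fin n) ℝ} {r : ℝ}
    (hD : (D, r) ∈ clarkeTangentCone
      {p : Matrix (Fin m) (Fin n) ℝ × ℝ | objective g f p.1 ≤ p.2} (A, objective g f A)) :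
    (η - 1) * ∑ i, (if 0 < sv A i then 0 else γ i * (Uᵀ * D * V) i i) ≤ r := by
  set K := Uᵀ * D * V with hK
  -- Symmetric part of D, in the frames of A, on the positive block; removing it leaves a direction
  -- that is skew there.
  set S₀ : Matrix (Fin m) (Fin m) ℝ := Matrix.of fun i j =>
    if 0 < sv A i ∧ 0 < sv A j then (K i j + K j i) / 2 else 0 with hS₀
  set S := U * S₀ * Vᵀ with hS
  set R := D - S with hRdef
  have hS₀t : S₀ᵀ = S₀ := by
    ext i j
    simp only [hS₀, Matrix.transpose_apply, Matrix.of_apply, and_comm, add_comm]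
  have hS₀0 : ∀ i j, ¬ (0 < sv A i ∧ 0 < sv A j) → S₀ i j = 0 := fun i j hij => by
    simp only [hS₀, Matrix.of_apply, if_neg hij]
  have hcS : Uᵀ * S * V = S₀ := by
    rw [hS, ← Matrix.mul_assoc, ← Matrix.mul_assoc, hA.left, Matrix.one_mul, Matrix.mul_assoc,
      hA.right, Matrix.mul_one]
  have hcR : Uᵀ * R * V = K - S₀ := by rw [hRdef, Matrix.mul_sub, Matrix.sub_mul, hcS]
  have hR : ∀ i j, 0 < sv A i → 0 < sv A j →
      (Uᵀ * R * V) i j + (Uᵀ * R * V) j i = 0 := by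
    intro i j hi hj
    rw [hcR, Matrix.sub_apply, Matrix.sub_apply]
    simp only [hS₀, Matrix.of_apply, hi, hj, and_self, if_true]
    ring
  set t : ℕ → ℝ := fun k => 1 / ((k : ℝ) + 1) with ht_def
  have ht0 : ∀ k, 0 < t k := fun k => by positivity
  have ht : Tendsto t atTop (𝓝 0) := tendsto_one_div_add_atTop_nhds_zero_nat
  have htw : Tendsto t atTop (𝓝[>] 0) :=
    tendsto_nhdsWithin_iff.mpr ⟨ht, Eventually.of_forall ht0⟩
  have hbase : Tendsto (fun k => A - t k • S) atTop (𝓝 A) := by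
    have := (ht.smul_const S).const_sub A
    rwa [zero_smul, sub_zero] at this
  -- Tangency is tested from the shifted points A - tS on the graph, not from A itself.
  obtain ⟨u, hu, huC⟩ := hD (fun k => (A - t k • S, objective g f (A - t k • S))) t
    (fun k => show objective g f _ ≤ objective g f _ from le_rfl)
    (hbase.prodMk_nhds (((continuous_objective hmn hg hf).tendsto A).comp hbase)) ht0 ht
  have hu1 : Tendsto (fun k => (u k).1) atTop (𝓝 D) := (continuous_fst.tendsto (D, r)).comp hu
  have hu2 : Tendsto (fun k => (u k).2) atTop (𝓝 r) := (continuous_snd.tendsto (D, r)).comp hu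
  have hQ : Tendsto (fun k => (u k).1 - S) atTop (𝓝 R) := hu1.sub_const S
  set Q : ℕ → Matrix (Fin m) (Fin n) ℝ := fun k => (u k).1 - S with hQdef
  obtain ⟨b, hb, hlow⟩ := exists_penalty_lower_bound hmn hg hA hR hQ ht0 ht hγ0 hγκ hκ hη hδ hδg
  have hup := htw.eventually (eventually_sum_penalty_sv_le hmn hg hA hγ hS₀t hS₀0)
  have hGinner : ∀ W, frobInner (matGrad f A) W = -∑ i, γ i * (Uᵀ * W * V) i i := by
    intro W
    have e : matGrad f A = (-1 : ℝ) • (U * Matrix.diagonal γ * Vᵀ) := by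
      rw [← hG, neg_one_smul, neg_neg]
    rw [e, frobInner_smul_left, frobInner_mul_mul, frobInner_diagonal, neg_one_mul]
  have hM : Tendsto (fun k => A + t k • Q k) atTop (𝓝 A) := by
    have := (ht.smul hQ).const_add A
    rwa [zero_smul, add_zero] at this
  have hgrad : Tendsto (fun k => frobInner (matGrad f (A + t k • Q k)) (Q k)) atTop
      (𝓝 (-∑ i, γ i * (Uᵀ * R * V) i i)) := by
    rw [← hGinner]
    exact tendsto_frobInner ((hf.continuous_matGrad.tendsto A).comp hM) hQ
  have hlim : Tendsto (fun k => b k + frobInner (matGrad f (A + t k • Q k)) (Q k) -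
      t k * (L / 2 * (‖Q k‖ ^ 2 + ‖S‖ ^ 2))) atTop
      (𝓝 ((η - 1) * ∑ i, γ i * (Uᵀ * R * V) i i)) := by
    have h := (hb.add hgrad).sub (ht.mul (((hQ.norm.pow 2).add_const (‖S‖ ^ 2)).const_mul (L / 2)))
    convert! h using 2
    ring
  have hsum : ∑ i, γ i * (Uᵀ * R * V) i i =
      ∑ i, if 0 < sv A i then 0 else γ i * K i i := by
    refine Finset.sum_congr rfl fun i _ => ?_
    rw [hcR, Matrix.sub_apply]
    split_ifs with hi
    · simp [hS₀, hi]
    · rw [hS₀0 i i fun h => hi h.1, sub_zero]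
  rw [← hsum]
  refine le_of_tendsto_of_tendsto hlim hu2 ?_
  filter_upwards [hlow, hup] with k h1 h2
  have hk := ht0 k
  have h3 : objective g f (A + t k • Q k) ≤ objective g f (A - t k • S) + t k * (u k).2 := by
    have h := huC k
    simp only [Set.mem_ofPred_eq, Prod.fst_add, Prod.snd_add, Prod.smul_fst, Prod.smul_snd,
      smul_eq_mul] at h
    have e : A + t k • Q k = A - t k • S + t k • (u k).1 := by
      rw [hQdef, smul_sub]; abel
    rw [e]
    exact h
  have h4 := hf.le_quadratic A (A - t k • S)
  have e4 : A - t k • S - A = (-t k) • S := by rw [neg_smul]; abel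
  rw [e4, frobInner_smul_right, hGinner, hcS, norm_smul, norm_neg, Real.norm_of_nonneg hk.le] at h4
  have h5 := hf.quadratic_le A (A + t k • Q k)
  rw [add_sub_cancel_left, frobInner_smul_right, norm_smul, Real.norm_of_nonneg hk.le] at h5
  simp only [objective] at h3
  refine le_of_mul_le_mul_left ?_ hk
  nlinarith

/-- κ is the largest γ_i on the zero block. It may equal a weight exactly, and only slopes strictly
below the weight are available, hence the factor η < 1. -/
theorem exists_zero_block_bound (hg : IsPenalty g) {σ γ : Fin m → ℝ} {v : Fin m → ℝ≥0∞}
    (hγ0 : ∀ i, σ i = 0 → 0 ≤ γ i)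
    (hγv : ∀ i, ∃ j, σ j = σ i ∧ (v j ≠ ∞ → γ i ≤ (v j).toReal))
    (hv : ∀ i c, ENNReal.ofReal c < v i → ∃ δ > 0, ∀ x, 0 ≤ x → x ≤ δ → g 0 + c * x ≤ g x) :
    ∃ κ, 0 ≤ κ ∧ (∀ i, σ i = 0 → γ i ≤ κ) ∧
      ∀ η, 0 ≤ η → η < 1 → ∃ δ > 0, ∀ x, 0 ≤ x → x ≤ δ → g 0 + η * κ * x ≤ g x := by
  have htriv : ∀ η : ℝ, ∃ δ > 0, ∀ x, 0 ≤ x → x ≤ δ → g 0 + η * 0 * x ≤ g x := fun η =>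
    ⟨1, one_pos, fun x hx _ => by
      simpa using hg.monotoneOn (Set.mem_Ici.mpr le_rfl) (Set.mem_Ici.mpr hx) hx⟩
  by_cases hne : (Finset.univ.filter fun i => σ i = 0).Nonempty
  · obtain ⟨i, hi, hmax⟩ := Finset.exists_max_image _ γ hne
    simp only [Finset.mem_filter, Finset.mem_univ, true_and] at hi hmax
    refine ⟨γ i, hγ0 i hi, hmax, fun η hη0 hη1 => ?_⟩
    rcases (hγ0 i hi).eq_or_lt with h0 | hpos
    · rw [← h0]
      exact htriv η
    · obtain ⟨j, -, hvj⟩ := hγv i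
      refine hv j (η * γ i) ?_
      by_cases hj : v j = ∞
      · rw [hj]
        exact ENNReal.ofReal_lt_top
      · rw [ENNReal.ofReal_lt_iff_lt_toReal (by positivity) hj]
        have := hvj hj
        nlinarith
  · refine ⟨0, le_rfl, fun i hi => absurd ⟨i, by simpa using hi⟩ hne, fun η _ _ => htriv η⟩

theorem IsSupergradient.of_between {a b c θ : ℝ} (ha : IsSupergradient g a θ)
    (hb : IsSupergradient g b θ) (hac : a ≤ c) (hcb : c ≤ b) : IsSupergradient g c θ := by
  intro y hy
  rcases le_total θ y with h | h
  · have := ha y hy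
    nlinarith
  · have := hb y hy
    nlinarith

end Stationary

end IRNN

theorem theorem2 {m n : ℕ} (hmn : m ≤ n)
    (g : ℝ → ℝ) (f : Matrix (Fin m) (Fin n) ℝ → ℝ) (L μ : ℝ)
    (hg : IRNN.IsPenalty g) (hf : IRNN.IsLoss f L) (hμ : L < μ)
    (X : ℕ → Matrix (Fin m) (Fin n) ℝ) (w : ℕ → Fin m → ENNReal)
    (hX : IRNN.IsIRNNSequence g f μ X w)
    (Xstar : Matrix (Fin m) (Fin n) ℝ) (hXstar : MapClusterPt Xstar Filter.atTop X) :
    IRNN.IsStationaryPoint (IRNN.objective g f) Xstar := by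
  obtain ⟨v, hv1, hv2, hmin⟩ := hX.exists_limit_weights hmn hg hf hμ hXstar
  have hfin : ∀ i, v i * ENNReal.ofReal (IRNN.sv Xstar i) ≠ ∞ := by
    intro i
    rcases (IRNN.sv_nonneg Xstar i).eq_or_lt with h | h
    · simp [← h]
    · exact ENNReal.mul_ne_top (hv1 i h).1 ENNReal.ofReal_ne_top
  have hZ : Xstar - μ⁻¹ • IRNN.matGrad f Xstar = Xstar + μ⁻¹ • -IRNN.matGrad f Xstar := by
    rw [smul_neg, sub_eq_add_neg]
  rw [hZ] at hmin
  obtain ⟨U, V, γ, hA, hG, hγ0, hγhi, hγlo⟩ :=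
    IRNN.subproblem_optimality hmn (hf.pos.trans hμ) hfin hmin
  have hγ : ∀ i, 0 < IRNN.sv Xstar i → IRNN.IsSupergradient g (γ i) (IRNN.sv Xstar i) := by
    intro i hi
    obtain ⟨j₁, hj₁, h₁⟩ := hγhi i
    obtain ⟨j₂, hj₂, h₂⟩ := hγlo i hi
    have s₁ := hv1 j₁ (hj₁ ▸ hi)
    have s₂ := hv1 j₂ (hj₂ ▸ hi)
    rw [hj₁] at s₁
    rw [hj₂] at s₂
    exact s₂.2.of_between s₁.2 h₂ (h₁ s₁.1)
  obtain ⟨κ, hκ, hγκ, hslope⟩ := IRNN.exists_zero_block_bound hg hγ0 hγhi hv2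
  intro D r hD
  have hbound : ∀ η, 0 ≤ η → η < 1 → (η - 1) * ∑ i, (if 0 < IRNN.sv Xstar i then 0 else
      γ i * (U.transpose * D * V) i i) ≤ r := by
    intro η hη0 hη1
    obtain ⟨δ, hδ, hδg⟩ := hslope η hη0 hη1
    exact IRNN.tangent_lower_bound hmn hg hf hA hG hγ hγ0 hγκ hκ hη0 hδ hδg hD
  have hr : 0 ≤ r := by
    set q := ∑ i, (if 0 < IRNN.sv Xstar i then 0 else γ i * (U.transpose * D * V) i i)
    -- The error on the zero block is a fixed multiple of η - 1, so it disappears as η increases to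
    -- 1.
    have hlim : Tendsto (fun η : ℝ => (η - 1) * q) (𝓝[<] 1) (𝓝 0) := by
      have : Tendsto (fun η : ℝ => (η - 1) * q) (𝓝 1) (𝓝 ((1 - 1) * q)) :=
        Continuous.tendsto (by fun_prop) 1
      rw [sub_self, zero_mul] at this
      exact this.mono_left nhdsWithin_le_nhds
    refine le_of_tendsto hlim ?_
    filter_upwards [Ico_mem_nhdsLT (zero_lt_one' ℝ)] with η hη
    exact hbound η hη.1 hη.2
  simpa [IRNN.frobInner] using hr
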